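/- **Setting.** Fix pairwise disjoint sets of numerals $\overline n$ (one for every $n\in\mathbb Z$), symbolic constants, and (countably many) variables. *Precomputed terms* are numerals, symbolic constants, and two symbols $\mathit{inf},\mathit{sup}$; a total order on them is fixed in which $\mathit{inf}$ is least, $\mathit{sup}$ is greatest, and numerals are contiguous and ordered as the integers. *Terms* are built from precomputed terms and variables by the binary symbols $+,-,\times,/,\backslash,..\,$; a ground term $t$ has a finite set $[t]$ of precomputed terms as values ($+,-,\times$ act on numerals in the usual way, $\overline m/\overline n$ and $\overline m\backslash\overline n$ have for $n\ne0$ the values $\lfloor m/n\rfloor$ and $m-n\lfloor m/n\rfloor$ and no value for $n=0$, and the values of $\overline m\,..\,\overline n$ are the numerals $\overline k$ with $m\le k\le n$); $[t_1,\dots,t_n]=[t_1]\times\dots\times[t_n]$. A *literal* is an atom $p(\mathbf t)$ ($p$ a symbolic constant) preceded by at most two occurrences of *not*; a *comparison* is $t_1\prec t_2$, where $\prec$ is one of $=,\ne,<,>,\le,\ge$. An *aggregate atom* is $\mathit{count}\{\mathbf X:\mathbf L\}\ge t$ or $\mathit{count}\{\mathbf X:\mathbf L\}\le t$, where $t$ is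 a term without $..$, $\mathbf X$ is a tuple of distinct variables, and $\mathbf L$ is a conjunction of literals and comparisons in which all members of $\mathbf X$ occur. A *rule* is $H\leftarrow B_1\land\dots\land B_n$, where each $B_i$ is a literal, a comparison or an aggregate atom, and the head $H$ is $p(\mathbf t)$, $\{p(\mathbf t)\}$ or empty. A variable of a rule is *local* if it occurs only inside aggregate elements $\mathbf X:\mathbf L$, and *global* otherwise; a rule is *pure* if in each of its aggregate elements $\mathbf X:\mathbf L$ all members of $\mathbf X$ are local. An *MGC program* (a program in mini-gringo with counting) is a finite set of pure rules. **Strong equivalence.** A *precomputed atom* is $p(\mathbf r)$ with a tuple $\mathbf r$ of precomputed terms. For ground $\mathbf t,t_1,t_2$: $\tau(p(\mathbf t))$, $\tau(\mathit{not}\ p(\mathbf t))$, $\tau(\mathit{not}\ \mathit{not}\ p(\mathbf t))$ are $\bigvee_{\mathbf r\in[\mathbf t]}p(\mathbf r)$, $\bigvee_{\mathbf r\in[\mathbf t]}\neg p(\mathbf r)$, $\bigvee_{\mathbf r\in[\mathbf t]}\neg\neg p(\mathbf r)$; $\tau(t_1\prec t_2)$ is $\top$ if $r_1\prec r_2$ for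 some $r_1\in[t_1]$, $r_2\in[t_2]$, and $\bot$ otherwise; $\tau$ of a conjunction is the conjunction of the results. For ground $t$ with $[t]=\{c\}$, $$\tau(\mathit{count}\{\mathbf X:\mathbf L\}\ge t)=\bigvee_{\Delta:\overline{|\Delta|}\ge c}\ \bigwedge_{\mathbf x\in\Delta}\bigvee_{\mathbf w}\tau(\mathbf L^{\mathbf X,\mathbf W}_{\mathbf x,\mathbf w}),\qquad \tau(\mathit{count}\{\mathbf X:\mathbf L\}\le t)=\bigwedge_{\Delta:\overline{|\Delta|}> c}\neg\bigwedge_{\mathbf x\in\Delta}\bigvee_{\mathbf w}\tau(\mathbf L^{\mathbf X,\mathbf W}_{\mathbf x,\mathbf w}),$$ where $\Delta$ ranges over finite sets of tuples of precomputed terms of the length of $\mathbf X$, $\mathbf W$ lists the variables of $\mathbf L$ not in $\mathbf X$, and $\mathbf w$ ranges over tuples of precomputed terms of the length of $\mathbf W$; if $[t]=\emptyset$, both are $\bot$. For a rule without global variables with body $B$ and head $p(\mathbf t)$, $\{p(\mathbf t)\}$ or empty, $\tau$ gives $\tau(B)\to\bigwedge_{\mathbf r\in[\mathbf t]}p(\mathbf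 r)$, $\tau(B)\to\bigwedge_{\mathbf r\in[\mathbf t]}(p(\mathbf r)\lor\neg p(\mathbf r))$, $\neg\tau(B)$ respectively. $\tau(\Pi)$ is the infinitary conjunction of $\tau(R)$ over all rules $R$ obtained from rules of $\Pi$ by substituting precomputed terms for all global variables. A set $I$ of atoms is a *stable model* of a set $\mathcal H$ of infinitary propositional formulas if it is minimal with respect to inclusion among the sets of atoms satisfying the reducts of all formulas of $\mathcal H$ with respect to $I$ (the reduct replaces atoms not in $I$ and implications not satisfied by $I$ by $\bot$). $\Pi_1$ and $\Pi_2$ are *strongly equivalent* if, for every set $\mathcal H$ of infinitary propositional formulas over the precomputed atoms, $\{\tau(\Pi_1)\}\cup\mathcal H$ and $\{\tau(\Pi_2)\}\cup\mathcal H$ have the same stable models. **The first-order translation.** Consider first-order formulas with variables of the sort *general* (including the variables of rules) and of its subsort *integer*. The signature $\sigma_0$ consists of the precomputed terms as constants (numerals being of sort integer), $+,-,\times$ on the sort integer, predicate constants $p/n$ for symbolic constants $p$, and the comparison symbols. The signature $\sigma_1$ contains additionally predicate constants $\mathit{Atleast}^{\mathbf X;\mathbf V}_F$ and $\mathit{Atmost}^{\mathbf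 X;\mathbf V}_F$ with $|\mathbf V|+1$ general arguments, for all disjoint lists $\mathbf X,\mathbf V$ of distinct general variables and all formulas $F$ over $\sigma_0$ whose free variables belong to $\mathbf X$ or $\mathbf V$. For a term $t$, $\mathit{val}_t(Z)$ is the formula over $\sigma_0$ expressing that $Z$ is a value of $t$: it is $Z=t$ if $t$ is a precomputed term or a variable; $\exists IJ(Z=I\circ J\land \mathit{val}_{t_1}(I)\land\mathit{val}_{t_2}(J))$ for $t_1\circ t_2$ with $\circ\in\{+,-,\times\}$; $\exists IJKR\,(D\land Z=K)$ for $t_1/t_2$ and $\exists IJKR\,(D\land Z=R)$ for $t_1\backslash t_2$, where $D$ is $I=J\times K+R\land\mathit{val}_{t_1}(I)\land\mathit{val}_{t_2}(J)\land J\ne\overline0\land((\overline0\le R\land R<J)\lor(J<R\land R\le\overline0))$; and $\exists IJK(\mathit{val}_{t_1}(I)\land\mathit{val}_{t_2}(J)\land I\le K\land K\le J\land Z=K)$ for $t_1..t_2$ ($I,J,K,R$ fresh integer variables). For tuples, $\mathit{val}_{\mathbf t}(\mathbf Z)$ is the conjunction of the formulas $\mathit{val}_{t_i}(Z_i)$.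 $\tau^B$ translates $p(\mathbf t)$, $\mathit{not}\ p(\mathbf t)$, $\mathit{not}\ \mathit{not}\ p(\mathbf t)$ into $\exists\mathbf Z(\mathit{val}_{\mathbf t}(\mathbf Z)\land A)$ with $A$ being $p(\mathbf Z)$, $\neg p(\mathbf Z)$, $\neg\neg p(\mathbf Z)$, translates $t_1\prec t_2$ into $\exists Z_1Z_2(\mathit{val}_{t_1}(Z_1)\land\mathit{val}_{t_2}(Z_2)\land Z_1\prec Z_2)$, and commutes with conjunction ($\mathbf Z,Z_1,Z_2$ fresh general variables). For a pure rule $H\leftarrow B_1\land\dots\land B_n$, let $B_i^*$ be $\tau^B(B_i)$ if $B_i$ is a literal or a comparison; $\exists C(\mathit{val}_t(C)\land\mathit{Atleast}^{\mathbf X;\mathbf V}_{\exists\mathbf W\tau^B(\mathbf L)}(\mathbf V,C))$ if $B_i$ is $\mathit{count}\{\mathbf X:\mathbf L\}\ge t$; and the same formula with $\mathit{Atmost}$ if $B_i$ is $\mathit{count}\{\mathbf X:\mathbf L\}\le t$; here $\mathbf V$ lists the global variables occurring in $\mathbf L$, $\mathbf W$ the local variables occurring in $\mathbf L$ but not in $\mathbf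 X$, and $C$ is a fresh general variable. $\tau^*(R)$ is the universal closure of $B_1^*\land\dots\land B_n^*\land\mathit{val}_{\mathbf t}(\mathbf Z)\to p(\mathbf Z)$ if $H$ is $p(\mathbf t)$, of the same implication with consequent $p(\mathbf Z)\lor\neg p(\mathbf Z)$ if $H$ is $\{p(\mathbf t)\}$, and of $\neg(B_1^*\land\dots\land B_n^*)$ if $H$ is empty, where $\mathbf Z$ is a tuple of fresh general variables. $\tau^*(\Pi)$ is the conjunction of the sentences $\tau^*(R)$ for the rules $R$ of $\Pi$. **Defs** is the set of all sentences $\forall\mathbf V(\mathit{Atleast}^{\mathbf X;\mathbf V}_F(\mathbf V,r)\leftrightarrow\exists_{\ge r}\mathbf X F)$ and $\forall\mathbf V(\mathit{Atmost}^{\mathbf X;\mathbf V}_F(\mathbf V,r)\leftrightarrow\exists_{\le r}\mathbf X F)$ with $r$ a precomputed term. Here $\exists_{\ge r}\mathbf XF$ is $\exists\mathbf X_1\cdots\mathbf X_n\bigl(\bigwedge_{i}F^{\mathbf X}_{\mathbf X_i}\land\bigwedge_{i<j}\neg(\mathbf X_i=\mathbf X_j)\bigr)$ if $r=\overline n>\overline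 0$, $\top$ if $r\le\overline0$, and $\bot$ if $r$ exceeds all numerals; $\exists_{\le r}\mathbf XF$ is $\forall\mathbf X_1\cdots\mathbf X_{n+1}\bigl(\bigwedge_{i}F^{\mathbf X}_{\mathbf X_i}\to\bigvee_{i<j}\mathbf X_i=\mathbf X_j\bigr)$ if $r=\overline n\ge\overline 0$, $\bot$ if $r<\overline0$, and $\top$ if $r$ exceeds all numerals. **HTA** (here-and-there with arithmetic) is two-sorted first-order intuitionistic logic with equality over $\sigma_1$, extended by the axiom schemas $F\lor(F\to G)\lor\neg G$; $\exists X(F\to\forall X F)$ for variables $X$ of either sort; all formulas without predicate constants other than comparison symbols that are true in the standard interpretation of precomputed terms, comparisons and arithmetic operations, for all values of their free variables; and induction $F^N_{\overline0}\land\forall N(N\ge\overline0\land F\to F^N_{N+\overline1})\to\forall N(N\ge\overline0\to F)$ for integer variables $N$. **Theorem.** For any MGC programs $\Pi_1$ and $\Pi_2$, if the formula $\tau^*(\Pi_1)\leftrightarrow\tau^*(\Pi_2)$ is derivable in HTA extended by the axioms Defs, then $\Pi_1$ and $\Pi_2$ are strongly equivalent to each other. -/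

import Mathlib

namespace MGC

/-! ## Precomputed terms and mini-gringo terms -/

/-- Precomputed terms over a set `S` of symbolic constants: numerals (one for each integer),
symbolic constants, and the two symbols `inf`, `sup`. -/
inductive PTerm (S : Type) : Type where
  | inf : PTerm S
  | num (n : ℤ) : PTerm S
  | sym (s : S) : PTerm S
  | sup : PTerm S

/-- The selected total order on precomputed terms: `inf` is least, `sup` is greatest, numerals are
contiguous and ordered in the standard way. -/
class PrecomputedOrder (S : Type) extends LinearOrder (PTerm S) where
  inf_le : ∀ r : PTerm S, PTerm.inf ≤ r
  le_sup : ∀ r : PTerm S, r ≤ PTerm.sup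
  num_le_num : ∀ m n : ℤ, (PTerm.num m : PTerm S) ≤ PTerm.num n ↔ m ≤ n
  contiguous : ∀ (m n : ℤ) (r : PTerm S),
    PTerm.num m ≤ r → r ≤ PTerm.num n → ∃ k : ℤ, r = PTerm.num k

/-- The six comparison symbols. -/
inductive CmpSym : Type where
  | eq | ne | lt | gt | le | ge

/-- The relation on precomputed terms denoted by a comparison symbol. -/
def CmpSym.Holds {S : Type} [PrecomputedOrder S] : CmpSym → PTerm S → PTerm S → Prop
  | .eq, a, b => a = b
  | .ne, a, b => a ≠ b
  | .lt, a, b => a < b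
  | .gt, a, b => a > b
  | .le, a, b => a ≤ b
  | .ge, a, b => a ≥ b

/-- The binary operation symbols `+`, `-`, `×`, `/`, `\`, `..`. -/
inductive BinOp : Type where
  | add | sub | mul | div | mod | interval

/-- Mini-gringo terms. Variables are indexed by natural numbers; they are at the same time the
general variables of the first-order language below. -/
inductive MTerm (S : Type) : Type where
  | pre (r : PTerm S) : MTerm S
  | var (x : ℕ) : MTerm S
  | op (o : BinOp) (t₁ t₂ : MTerm S) : MTerm S

namespace MTerm

/-- The variables that occur in a term. -/
def vars {S : Type} : MTerm S → List ℕ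
  | pre _ => []
  | var x => [x]
  | op _ t₁ t₂ => t₁.vars ++ t₂.vars

/-- The term does not contain `..`. -/
def IntervalFree {S : Type} : MTerm S → Prop
  | pre _ => True
  | var _ => True
  | op o t₁ t₂ => o ≠ BinOp.interval ∧ t₁.IntervalFree ∧ t₂.IntervalFree

/-- Substitution of precomputed terms for some of the variables. -/
def subst {S : Type} (θ : ℕ → Option (PTerm S)) : MTerm S → MTerm S
  | pre r => pre r
  | var x => match θ x with
    | some r => pre r
    | none => var x
  | op o t₁ t₂ => op o (t₁.subst θ) (t₂.subst θ)

/-- The set `[t]` of values of a ground term `t`. (The clause for variables is irrelevant.) -/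
def values {S : Type} : MTerm S → Set (PTerm S)
  | pre r => {r}
  | var _ => ∅
  | op .add t₁ t₂ => {r | ∃ m n : ℤ, .num m ∈ t₁.values ∧ .num n ∈ t₂.values ∧ r = .num (m + n)}
  | op .sub t₁ t₂ => {r | ∃ m n : ℤ, .num m ∈ t₁.values ∧ .num n ∈ t₂.values ∧ r = .num (m - n)}
  | op .mul t₁ t₂ => {r | ∃ m n : ℤ, .num m ∈ t₁.values ∧ .num n ∈ t₂.values ∧ r = .num (m * n)}
  | op .div t₁ t₂ => {r | ∃ m n : ℤ, .num m ∈ t₁.values ∧ .num n ∈ t₂.values ∧ n ≠ 0 ∧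
      r = .num ⌊(m : ℚ) / (n : ℚ)⌋}
  | op .mod t₁ t₂ => {r | ∃ m n : ℤ, .num m ∈ t₁.values ∧ .num n ∈ t₂.values ∧ n ≠ 0 ∧
      r = .num (m - n * ⌊(m : ℚ) / (n : ℚ)⌋)}
  | op .interval t₁ t₂ => {r | ∃ m n k : ℤ, .num m ∈ t₁.values ∧ .num n ∈ t₂.values ∧
      m ≤ k ∧ k ≤ n ∧ r = .num k}

theorem IntervalFree.subst {S : Type} (θ : ℕ → Option (PTerm S)) :
    ∀ {t : MTerm S}, t.IntervalFree → (t.subst θ).IntervalFree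
  | .pre _, _ => trivial
  | .var x, _ => by
      unfold MTerm.subst
      split <;> trivial
  | .op _ _ _, h => ⟨h.1, IntervalFree.subst θ h.2.1, IntervalFree.subst θ h.2.2⟩

theorem mem_vars_subst {S : Type} {θ : ℕ → Option (PTerm S)} {x : ℕ} (hx : θ x = none) :
    ∀ {t : MTerm S}, x ∈ t.vars → x ∈ (t.subst θ).vars
  | .pre _, h => h
  | .var y, h => by
      have hy : x = y := by simpa [vars] using h
      subst hy
      simp [MTerm.subst, hx, vars]
  | .op _ t₁ t₂, h => by
      have h' : x ∈ t₁.vars ∨ x ∈ t₂.vars := by simpa [vars] using h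
      have : x ∈ (t₁.subst θ).vars ∨ x ∈ (t₂.subst θ).vars :=
        h'.imp (mem_vars_subst hx) (mem_vars_subst hx)
      simpa [MTerm.subst, vars] using this

end MTerm

/-- The set `[t₁, …, tₙ]` of tuples of values. -/
def tupleValues {S : Type} (ts : List (MTerm S)) : Set (List (PTerm S)) :=
  {rs | List.Forall₂ (fun t r => r ∈ t.values) ts rs}

/-! ## Rules and programs of mini-gringo with counting -/

/-- An atom is preceded by zero, one or two occurrences of `not`. -/
inductive Sign : Type where
  | pos | neg | negneg

/-- Literals and comparisons. -/
inductive Basic (S : Type) : Type where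
  | lit (s : Sign) (p : S) (ts : List (MTerm S)) : Basic S
  | cmp (c : CmpSym) (t₁ t₂ : MTerm S) : Basic S

def Basic.vars {S : Type} : Basic S → List ℕ
  | .lit _ _ ts => ts.flatMap MTerm.vars
  | .cmp _ t₁ t₂ => t₁.vars ++ t₂.vars

def Basic.subst {S : Type} (θ : ℕ → Option (PTerm S)) : Basic S → Basic S
  | .lit s p ts => .lit s p (ts.map (MTerm.subst θ))
  | .cmp c t₁ t₂ => .cmp c (t₁.subst θ) (t₂.subst θ)

theorem Basic.mem_vars_subst {S : Type} {θ : ℕ → Option (PTerm S)} {x : ℕ} (hx : θ x = none) :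
    ∀ {B : Basic S}, x ∈ B.vars → x ∈ (B.subst θ).vars
  | .lit _ _ ts, h => by
      obtain ⟨t, ht, hxt⟩ := List.mem_flatMap.1 h
      exact List.mem_flatMap.2 ⟨t.subst θ, List.mem_map_of_mem ht, MTerm.mem_vars_subst hx hxt⟩
  | .cmp _ _ _, h => List.mem_append.2 ((List.mem_append.1 h).imp
      (MTerm.mem_vars_subst hx) (MTerm.mem_vars_subst hx))

/-- Variables of a conjunction of literals and comparisons. -/
def conjVars {S : Type} (L : List (Basic S)) : List ℕ := L.flatMap Basic.vars

/-- Aggregate elements `X : L`, where `X` is a tuple of distinct variables, each occurring in the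
conjunction `L` of literals and comparisons. -/
structure AggElem (S : Type) where
  X : List ℕ
  L : List (Basic S)
  nodup : X.Nodup
  occurs : ∀ x ∈ X, x ∈ conjVars L

/-- Substitution for variables different from the members of `X`. -/
def AggElem.subst {S : Type} (θ : ℕ → Option (PTerm S)) (E : AggElem S) : AggElem S where
  X := E.X
  L := E.L.map (Basic.subst fun v => if v ∈ E.X then none else θ v)
  nodup := E.nodup
  occurs := by
    intro x hx
    obtain ⟨B, hB, hxB⟩ := List.mem_flatMap.1 (E.occurs x hx)
    exact List.mem_flatMap.2 ⟨_, List.mem_map_of_mem hB, Basic.mem_vars_subst (by simp [hx]) hxB⟩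

/-- `atLeast` is used for `count{E} ≥ t`, and `atMost` for `count{E} ≤ t`. -/
inductive CountRel : Type where
  | atLeast | atMost

/-- Members of the body of a rule: literals, comparisons, aggregate atoms. -/
inductive BodyElem (S : Type) : Type where
  | basic (B : Basic S) : BodyElem S
  | count (rel : CountRel) (E : AggElem S) (t : MTerm S) (ht : t.IntervalFree) : BodyElem S

/-- Variables having an occurrence outside of an aggregate element. -/
def BodyElem.outerVars {S : Type} : BodyElem S → List ℕ
  | .basic B => B.vars
  | .count _ _ t _ => t.vars

def BodyElem.subst {S : Type} (θ : ℕ → Option (PTerm S)) : BodyElem S → BodyElem S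
  | .basic B => .basic (B.subst θ)
  | .count rel E t ht => .count rel (E.subst θ) (t.subst θ) (ht.subst θ)

/-- The head of a basic rule, of a choice rule, of a constraint. -/
inductive Head (S : Type) : Type where
  | atom (p : S) (ts : List (MTerm S)) : Head S
  | choice (p : S) (ts : List (MTerm S)) : Head S
  | empty : Head S

def Head.vars {S : Type} : Head S → List ℕ
  | .atom _ ts => ts.flatMap MTerm.vars
  | .choice _ ts => ts.flatMap MTerm.vars
  | .empty => []

def Head.subst {S : Type} (θ : ℕ → Option (PTerm S)) : Head S → Head S
  | .atom p ts => .atom p (ts.map (MTerm.subst θ))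
  | .choice p ts => .choice p (ts.map (MTerm.subst θ))
  | .empty => .empty

structure Rule (S : Type) where
  head : Head S
  body : List (BodyElem S)

namespace Rule

/-- The list, without repetitions, of the global variables of a rule. -/
def globals {S : Type} (R : Rule S) : List ℕ :=
  (R.head.vars ++ R.body.flatMap BodyElem.outerVars).dedup

/-- For every aggregate element `X : L` in the body, all members of `X` are local. -/
def Pure {S : Type} (R : Rule S) : Prop :=
  ∀ (rel : CountRel) (E : AggElem S) (t : MTerm S) (ht : t.IntervalFree),
    BodyElem.count rel E t ht ∈ R.body → ∀ x ∈ E.X, x ∉ R.globals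

/-- The closed rule obtained by substituting the precomputed terms `v x` for the global
variables `x`. -/
def inst {S : Type} (R : Rule S) (v : ℕ → PTerm S) : Rule S :=
  let θ : ℕ → Option (PTerm S) := fun x => if x ∈ R.globals then some (v x) else none
  ⟨R.head.subst θ, R.body.map (BodyElem.subst θ)⟩

end Rule

/-- A program in mini-gringo with counting: a finite set of pure rules, given by any list of its
members. -/
structure Program (S : Type) where
  rules : List (Rule S)
  pure : ∀ R ∈ rules, R.Pure

/-! ## Infinitary propositional formulas, stable models, strong equivalence -/

/-- Infinitary propositional formulas over the signature `A`. The conjunction and the disjunction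
of a set of formulas are written as the conjunction and the disjunction of a family. -/
inductive InfFormula (A : Type) : Type 1 where
  | atom (a : A) : InfFormula A
  | conj (ι : Type) (f : ι → InfFormula A) : InfFormula A
  | disj (ι : Type) (f : ι → InfFormula A) : InfFormula A
  | imp (F G : InfFormula A) : InfFormula A

namespace InfFormula

def bot {A : Type} : InfFormula A := disj Empty Empty.elim

def top {A : Type} : InfFormula A := conj Empty Empty.elim

def neg {A : Type} (F : InfFormula A) : InfFormula A := imp F bot

/-- Binary disjunction. -/
def or {A : Type} (F G : InfFormula A) : InfFormula A :=
  disj Bool fun b => if b then F else G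

/-- The conjunction of a finite list. -/
def listConj {A : Type} (l : List (InfFormula A)) : InfFormula A :=
  conj (Fin l.length) fun i => l.get i

/-- Satisfaction by an interpretation (a set of atoms). -/
def Sat {A : Type} (I : Set A) : InfFormula A → Prop
  | atom a => a ∈ I
  | conj _ f => ∀ i, (f i).Sat I
  | disj _ f => ∃ i, (f i).Sat I
  | imp F G => F.Sat I → G.Sat I

open Classical in
/-- The reduct of a formula relative to an interpretation. -/
noncomputable def reduct {A : Type} (I : Set A) : InfFormula A → InfFormula A
  | atom a => if a ∈ I then atom a else bot
  | conj ι f => conj ι fun i => (f i).reduct I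
  | disj ι f => disj ι fun i => (f i).reduct I
  | imp F G => if (imp F G).Sat I then imp (F.reduct I) (G.reduct I) else bot

/-- `I` is a stable model of a set of formulas: it is minimal, relative to set inclusion, among the
interpretations satisfying the reducts of all formulas of the set relative to `I`. -/
def StableModel {A : Type} (H : Set (InfFormula A)) (I : Set A) : Prop :=
  Minimal (fun J : Set A => ∀ F ∈ H, (F.reduct I).Sat J) I

/-- Strong equivalence of infinitary propositional formulas. -/
def StronglyEquivalent {A : Type} (F G : InfFormula A) : Prop :=
  ∀ (H : Set (InfFormula A)) (I : Set A), StableModel ({F} ∪ H) I ↔ StableModel ({G} ∪ H) I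

end InfFormula

/-! ## The translation `τ` -/

/-- Precomputed atoms `p(r₁, …, rₙ)`. -/
structure PAtom (S : Type) where
  p : S
  args : List (PTerm S)

/-- A literal of the given sign. -/
def Sign.apply {A : Type} : Sign → InfFormula A → InfFormula A
  | .pos, F => F
  | .neg, F => F.neg
  | .negneg, F => F.neg.neg

open Classical in
/-- `τ` for ground literals and ground comparisons. -/
noncomputable def Basic.tau {S : Type} [PrecomputedOrder S] : Basic S → InfFormula (PAtom S)
  | .lit s p ts => .disj {rs : List (PTerm S) // rs ∈ tupleValues ts} fun rs =>
      s.apply (.atom ⟨p, rs.1⟩)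
  | .cmp c t₁ t₂ =>
      if ∃ r₁ ∈ t₁.values, ∃ r₂ ∈ t₂.values, c.Holds r₁ r₂ then .top else .bot

/-- The assignment of the members of a tuple `x` of precomputed terms to the members of a list `X`
of distinct variables. -/
def tupleSubst {S : Type} (X : List ℕ) (x : Fin X.length → PTerm S) : ℕ → Option (PTerm S) :=
  fun v => if h : X.idxOf v < X.length then some (x ⟨X.idxOf v, h⟩) else none

/-- The list of variables that occur in `L` but do not belong to `X`. -/
def AggElem.otherVars {S : Type} (E : AggElem S) : List ℕ :=
  (conjVars E.L).dedup.filter (· ∉ E.X)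

/-- The disjunction, over all tuples `w` of precomputed terms, of the results of applying `τ` to
`L` with `x` substituted for `X` and `w` for the other variables. -/
noncomputable def AggElem.tauAt {S : Type} [PrecomputedOrder S] (E : AggElem S)
    (x : Fin E.X.length → PTerm S) : InfFormula (PAtom S) :=
  .disj (Fin E.otherVars.length → PTerm S) fun w =>
    .listConj (E.L.map fun B =>
      ((B.subst (tupleSubst E.X x)).subst (tupleSubst E.otherVars w)).tau)

open Classical in
/-- `τ` for literals, comparisons and aggregate atoms in the body of a closed rule. In an aggregate
atom, `t` is ground and interval-free, so that it has at most one value `c`. -/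
noncomputable def BodyElem.tau {S : Type} [PrecomputedOrder S] :
    BodyElem S → InfFormula (PAtom S)
  | .basic B => B.tau
  | .count rel E t _ =>
      if h : t.values.Nonempty then
        let c : PTerm S := h.some
        match rel with
        | .atLeast =>
            .disj {Δ : Finset (Fin E.X.length → PTerm S) // PTerm.num (Δ.card : ℤ) ≥ c} fun Δ =>
              .conj {x // x ∈ Δ.1} fun x => E.tauAt x.1
        | .atMost =>
            .conj {Δ : Finset (Fin E.X.length → PTerm S) // PTerm.num (Δ.card : ℤ) > c} fun Δ =>
              (InfFormula.conj {x // x ∈ Δ.1} fun x => E.tauAt x.1).neg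
      else .bot

/-- `τ` for closed rules. -/
noncomputable def Rule.tau {S : Type} [PrecomputedOrder S] (R : Rule S) : InfFormula (PAtom S) :=
  let body : InfFormula (PAtom S) := .listConj (R.body.map BodyElem.tau)
  match R.head with
  | .atom p ts => .imp body (.conj {rs : List (PTerm S) // rs ∈ tupleValues ts} fun rs =>
      .atom ⟨p, rs.1⟩)
  | .choice p ts => .imp body (.conj {rs : List (PTerm S) // rs ∈ tupleValues ts} fun rs =>
      .or (.atom ⟨p, rs.1⟩) (InfFormula.neg (.atom ⟨p, rs.1⟩)))
  | .empty => body.neg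

/-- `τ(Π)`: the conjunction of `τ(R)` over all closed rules `R` obtained from rules of the program
by substituting precomputed terms for global variables. -/
noncomputable def Program.tau {S : Type} [PrecomputedOrder S] (P : Program S) :
    InfFormula (PAtom S) :=
  .conj (Fin P.rules.length × (ℕ → PTerm S)) fun i => ((P.rules.get i.1).inst i.2).tau

/-- Strong equivalence of programs. -/
def Program.StronglyEquivalent {S : Type} [PrecomputedOrder S] (P₁ P₂ : Program S) : Prop :=
  InfFormula.StronglyEquivalent P₁.tau P₂.tau

/-! ## Two-sorted first-order formulas -/

/-- Terms of the sort *integer*. -/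
inductive ITerm : Type where
  | num (n : ℤ) : ITerm
  | var (n : ℕ) : ITerm
  | add (t₁ t₂ : ITerm) : ITerm
  | sub (t₁ t₂ : ITerm) : ITerm
  | mul (t₁ t₂ : ITerm) : ITerm

/-- Terms of the sort *general*; *integer* is a subsort. -/
inductive GTerm (S : Type) : Type where
  | int (t : ITerm) : GTerm S
  | inf : GTerm S
  | sym (s : S) : GTerm S
  | sup : GTerm S
  | var (x : ℕ) : GTerm S

/-- Precomputed terms are object constants. -/
def PTerm.toGTerm {S : Type} : PTerm S → GTerm S
  | .inf => .inf
  | .num n => .int (.num n)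
  | .sym s => .sym s
  | .sup => .sup

/-- The predicate constants of a signature, other than comparison symbols; all their arguments are
of the sort *general*. -/
structure Signature where
  Pred : Type
  arity : Pred → ℕ

/-- First-order formulas. `allG`, `exG` bind general variables, and `allI`, `exI` bind integer
variables. -/
inductive Formula (S : Type) (σ : Signature) : Type where
  | bot : Formula S σ
  | pred (q : σ.Pred) (ts : Fin (σ.arity q) → GTerm S) : Formula S σ
  | cmp (c : CmpSym) (t₁ t₂ : GTerm S) : Formula S σ
  | and (F G : Formula S σ) : Formula S σ
  | or (F G : Formula S σ) : Formula S σ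
  | imp (F G : Formula S σ) : Formula S σ
  | allG (x : ℕ) (F : Formula S σ) : Formula S σ
  | exG (x : ℕ) (F : Formula S σ) : Formula S σ
  | allI (n : ℕ) (F : Formula S σ) : Formula S σ
  | exI (n : ℕ) (F : Formula S σ) : Formula S σ

/-- The integer variable `n` occurs in the term. -/
def ITerm.OccI (n : ℕ) : ITerm → Prop
  | .num _ => False
  | .var m => m = n
  | .add t₁ t₂ => t₁.OccI n ∨ t₂.OccI n
  | .sub t₁ t₂ => t₁.OccI n ∨ t₂.OccI n
  | .mul t₁ t₂ => t₁.OccI n ∨ t₂.OccI n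

def GTerm.OccI {S : Type} (n : ℕ) : GTerm S → Prop
  | .int t => t.OccI n
  | _ => False

/-- The general variable `x` occurs in the term. -/
def GTerm.OccG {S : Type} (x : ℕ) : GTerm S → Prop
  | .var y => y = x
  | _ => False

/-- A simultaneous substitution of terms for general and integer variables. -/
structure Subst (S : Type) where
  g : ℕ → GTerm S
  i : ℕ → ITerm

namespace Subst

def singleG {S : Type} (x : ℕ) (t : GTerm S) : Subst S :=
  ⟨Function.update GTerm.var x t, ITerm.var⟩

def singleI {S : Type} (n : ℕ) (t : ITerm) : Subst S :=
  ⟨GTerm.var, Function.update ITerm.var n t⟩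

/-- The substitution to be applied within the scope of a quantifier binding `x`. -/
def keepG {S : Type} (θ : Subst S) (x : ℕ) : Subst S :=
  ⟨Function.update θ.g x (GTerm.var x), θ.i⟩

def keepI {S : Type} (θ : Subst S) (n : ℕ) : Subst S :=
  ⟨θ.g, Function.update θ.i n (ITerm.var n)⟩

end Subst

def ITerm.subst (θ : ℕ → ITerm) : ITerm → ITerm
  | .num n => .num n
  | .var n => θ n
  | .add t₁ t₂ => .add (t₁.subst θ) (t₂.subst θ)
  | .sub t₁ t₂ => .sub (t₁.subst θ) (t₂.subst θ)
  | .mul t₁ t₂ => .mul (t₁.subst θ) (t₂.subst θ)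

def GTerm.subst {S : Type} (θ : Subst S) : GTerm S → GTerm S
  | .int t => .int (t.subst θ.i)
  | .inf => .inf
  | .sym s => .sym s
  | .sup => .sup
  | .var x => θ.g x

namespace Formula

def neg {S : Type} {σ : Signature} (F : Formula S σ) : Formula S σ := imp F bot

def top {S : Type} {σ : Signature} : Formula S σ := imp bot bot

def iff {S : Type} {σ : Signature} (F G : Formula S σ) : Formula S σ := and (imp F G) (imp G F)

/-- The conjunction of a list of formulas. -/
def bigAnd {S : Type} {σ : Signature} : List (Formula S σ) → Formula S σ
  | [] => top
  | [F] => F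
  | F :: G :: l => and F (bigAnd (G :: l))

/-- The disjunction of a list of formulas. -/
def bigOr {S : Type} {σ : Signature} : List (Formula S σ) → Formula S σ
  | [] => bot
  | [F] => F
  | F :: G :: l => or F (bigOr (G :: l))

/-- A string of universal quantifiers. -/
def allsG {S : Type} {σ : Signature} (xs : List ℕ) (F : Formula S σ) : Formula S σ :=
  xs.foldr allG F

/-- A string of existential quantifiers. -/
def exsG {S : Type} {σ : Signature} (xs : List ℕ) (F : Formula S σ) : Formula S σ :=
  xs.foldr exG F

/-- The general variable `x` is free in the formula. -/
def FreeG {S : Type} {σ : Signature} (x : ℕ) : Formula S σ → Prop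
  | bot => False
  | pred _ ts => ∃ i, (ts i).OccG x
  | cmp _ t₁ t₂ => t₁.OccG x ∨ t₂.OccG x
  | and F G => F.FreeG x ∨ G.FreeG x
  | or F G => F.FreeG x ∨ G.FreeG x
  | imp F G => F.FreeG x ∨ G.FreeG x
  | allG y F => x ≠ y ∧ F.FreeG x
  | exG y F => x ≠ y ∧ F.FreeG x
  | allI _ F => F.FreeG x
  | exI _ F => F.FreeG x

/-- The integer variable `n` is free in the formula. -/
def FreeI {S : Type} {σ : Signature} (n : ℕ) : Formula S σ → Prop
  | bot => False
  | pred _ ts => ∃ i, (ts i).OccI n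
  | cmp _ t₁ t₂ => t₁.OccI n ∨ t₂.OccI n
  | and F G => F.FreeI n ∨ G.FreeI n
  | or F G => F.FreeI n ∨ G.FreeI n
  | imp F G => F.FreeI n ∨ G.FreeI n
  | allG _ F => F.FreeI n
  | exG _ F => F.FreeI n
  | allI m F => n ≠ m ∧ F.FreeI n
  | exI m F => n ≠ m ∧ F.FreeI n

/-- A number greater than all indices of general variables occurring in the term. -/
def _root_.MGC.GTerm.freshG {S : Type} : GTerm S → ℕ
  | .var x => x + 1
  | _ => 0

/-- A number greater than all indices of general variables, free or bound, of the formula. -/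
def freshG {S : Type} {σ : Signature} : Formula S σ → ℕ
  | bot => 0
  | pred _ ts => Finset.univ.sup fun i => (ts i).freshG
  | cmp _ t₁ t₂ => max t₁.freshG t₂.freshG
  | and F G => max F.freshG G.freshG
  | or F G => max F.freshG G.freshG
  | imp F G => max F.freshG G.freshG
  | allG x F => max (x + 1) F.freshG
  | exG x F => max (x + 1) F.freshG
  | allI _ F => F.freshG
  | exI _ F => F.freshG

/-- Substitution for free occurrences of variables (without renaming bound variables). -/
def subst {S : Type} {σ : Signature} (θ : Subst S) : Formula S σ → Formula S σ
  | bot => bot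
  | pred q ts => pred q fun i => (ts i).subst θ
  | cmp c t₁ t₂ => cmp c (t₁.subst θ) (t₂.subst θ)
  | and F G => and (F.subst θ) (G.subst θ)
  | or F G => or (F.subst θ) (G.subst θ)
  | imp F G => imp (F.subst θ) (G.subst θ)
  | allG x F => allG x (F.subst (θ.keepG x))
  | exG x F => exG x (F.subst (θ.keepG x))
  | allI n F => allI n (F.subst (θ.keepI n))
  | exI n F => exI n (F.subst (θ.keepI n))

/-- The terms that `θ` substitutes for free variables of `F` other than `x` do not contain the
general variable `x`. -/
def AvoidsG {S : Type} {σ : Signature} (θ : Subst S) (x : ℕ) (F : Formula S σ) : Prop :=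
  ∀ y, y ≠ x → F.FreeG y → ¬ (θ.g y).OccG x

/-- The terms that `θ` substitutes for free variables of `F` other than `n` do not contain the
integer variable `n`. -/
def AvoidsI {S : Type} {σ : Signature} (θ : Subst S) (n : ℕ) (F : Formula S σ) : Prop :=
  (∀ y, F.FreeG y → ¬ (θ.g y).OccI n) ∧ ∀ m, m ≠ n → F.FreeI m → ¬ (θ.i m).OccI n

/-- The terms that `θ` substitutes for variables are free for these variables in the formula: no
variable of these terms is captured by a quantifier. -/
def FreeFor {S : Type} {σ : Signature} (θ : Subst S) : Formula S σ → Prop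
  | bot => True
  | pred _ _ => True
  | cmp _ _ _ => True
  | and F G => F.FreeFor θ ∧ G.FreeFor θ
  | or F G => F.FreeFor θ ∧ G.FreeFor θ
  | imp F G => F.FreeFor θ ∧ G.FreeFor θ
  | allG x F => F.AvoidsG θ x ∧ F.FreeFor (θ.keepG x)
  | exG x F => F.AvoidsG θ x ∧ F.FreeFor (θ.keepG x)
  | allI n F => F.AvoidsI θ n ∧ F.FreeFor (θ.keepI n)
  | exI n F => F.AvoidsI θ n ∧ F.FreeFor (θ.keepI n)

end Formula

/-! ## The signatures `σ₀` and `σ₁` -/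

/-- The predicate constants `p/n`. -/
abbrev sigma0 (S : Type) : Signature := ⟨S × ℕ, Prod.snd⟩

/-- The predicate constants `Atleast` and `Atmost` with the superscript `X;V` and the
subscript `F`. -/
structure CountPred (S : Type) where
  rel : CountRel
  X : List ℕ
  V : List ℕ
  F : Formula S (sigma0 S)
  nodup_X : X.Nodup
  nodup_V : V.Nodup
  disjoint : ∀ x ∈ X, x ∉ V
  freeG : ∀ x, F.FreeG x → x ∈ X ∨ x ∈ V
  freeI : ∀ n, ¬ F.FreeI n

/-- The signature `σ₀` extended by all constants `Atleast`, `Atmost`. -/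
abbrev sigma1 (S : Type) : Signature :=
  ⟨(S × ℕ) ⊕ CountPred S, Sum.elim Prod.snd fun q => q.V.length + 1⟩

/-- Formulas over `σ₀` are formulas over `σ₁`. -/
def Formula.toSigma1 {S : Type} : Formula S (sigma0 S) → Formula S (sigma1 S)
  | .bot => .bot
  | .pred q ts => .pred (Sum.inl q) ts
  | .cmp c t₁ t₂ => .cmp c t₁ t₂
  | .and F G => .and F.toSigma1 G.toSigma1
  | .or F G => .or F.toSigma1 G.toSigma1
  | .imp F G => .imp F.toSigma1 G.toSigma1
  | .allG x F => .allG x F.toSigma1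
  | .exG x F => .exG x F.toSigma1
  | .allI n F => .allI n F.toSigma1
  | .exI n F => .exI n F.toSigma1

/-- The atomic formula `p(t₁, …, tₙ)`. -/
def atomF {S : Type} (p : S) (ts : List (GTerm S)) : Formula S (sigma0 S) :=
  .pred (σ := sigma0 S) (p, ts.length) ts.get

/-- The atomic formula formed from `Atleast` or `Atmost`, the variables `V` and a term. -/
def CountPred.app {S : Type} (q : CountPred S) (c : GTerm S) : Formula S (sigma1 S) :=
  .pred (σ := sigma1 S) (Sum.inr q)
    (Fin.snoc (α := fun _ => GTerm S) (fun i : Fin q.V.length => GTerm.var (q.V.get i)) c)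

/-! ## The sentences `Defs` -/

/-- The `n` general variables with the indices `b, b + 1, …`. -/
def freshList (b n : ℕ) : List ℕ := (List.range n).map (b + ·)

/-- A number greater than all members of a list. -/
def above (l : List ℕ) : ℕ := l.foldr (fun x m => max (x + 1) m) 0

section Counting

/- The `i`-th tuple of fresh general variables (counting from 0) consists of the variables with
the indices `b + i * X.length + k` for `k < X.length`. -/

/-- The result of replacing `X` in `F` by the `i`-th tuple of fresh variables. -/
def copyF {S : Type} (X : List ℕ) (F : Formula S (sigma0 S)) (b i : ℕ) : Formula S (sigma0 S) :=
  F.subst ⟨fun v => if X.idxOf v < X.length then .var (b + i * X.length + X.idxOf v) else .var v,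
    ITerm.var⟩

/-- Equality between the `i`-th and the `j`-th tuple of fresh variables. -/
def tupleEq {S : Type} (X : List ℕ) (b i j : ℕ) : Formula S (sigma0 S) :=
  .bigAnd ((List.range X.length).map fun k =>
    .cmp .eq (.var (b + i * X.length + k)) (.var (b + j * X.length + k)))

/-- The pairs `(i, j)` such that `i < j < n`. -/
def pairs (n : ℕ) : List (ℕ × ℕ) :=
  (List.range n).flatMap fun j => (List.range j).map fun i => (i, j)

/-- `F` holds for at least `n` values of `X`; `b` exceeds the indices of the variables used. -/
def atLeastF {S : Type} (X : List ℕ) (F : Formula S (sigma0 S)) (b n : ℕ) :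
    Formula S (sigma0 S) :=
  .exsG (freshList b (n * X.length))
    (.and (.bigAnd ((List.range n).map (copyF X F b)))
      (.bigAnd ((pairs n).map fun ij => (tupleEq X b ij.1 ij.2).neg)))

/-- `F` holds for at most `n` values of `X`; `b` exceeds the indices of the variables used. -/
def atMostF {S : Type} (X : List ℕ) (F : Formula S (sigma0 S)) (b n : ℕ) :
    Formula S (sigma0 S) :=
  .allsG (freshList b ((n + 1) * X.length))
    (.imp (.bigAnd ((List.range (n + 1)).map (copyF X F b)))
      (.bigOr ((pairs (n + 1)).map fun ij => tupleEq X b ij.1 ij.2)))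

end Counting

/-- The expressions `∃_{≥ r} X F` and `∃_{≤ r} X F` for a precomputed term `r`. A precomputed term
that is greater than the numeral 0 and is not a numeral is greater than all numerals; one that is
not less than the numeral 0 and is not a numeral is greater than all numerals as well. -/
def CountPred.expansion {S : Type} [PrecomputedOrder S] (q : CountPred S) (r : PTerm S) :
    Formula S (sigma0 S) :=
  let b := max q.F.freshG (above (q.X ++ q.V))
  match q.rel with
  | .atLeast =>
      if r ≤ .num 0 then .top
      else match r with
        | .num n => atLeastF q.X q.F b n.toNat
        | _ => .bot
  | .atMost =>
      if r < .num 0 then .bot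
      else match r with
        | .num n => atMostF q.X q.F b n.toNat
        | _ => .top

/-- The set `Defs` of sentences over `σ₁`. -/
def Defs (S : Type) [PrecomputedOrder S] : Set (Formula S (sigma1 S)) :=
  {D | ∃ (q : CountPred S) (r : PTerm S),
    D = .allsG q.V (.iff (q.app r.toGTerm) (q.expansion r).toSigma1)}

/-! ## The translations `val`, `τ^B` and `τ*` -/

/-- The formula `val_t(Z)`. The bound integer variables have indices `k, k + 1, …`; the term `Z`
does not contain such variables. -/
def MTerm.val {S : Type} {σ : Signature} : MTerm S → ℕ → GTerm S → Formula S σ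
  | pre r, _, Z => .cmp .eq Z r.toGTerm
  | var x, _, Z => .cmp .eq Z (.var x)
  | op o t₁ t₂, k, Z =>
      let I : ITerm := .var k
      let J : ITerm := .var (k + 1)
      let K : ITerm := .var (k + 2)
      let R : ITerm := .var (k + 3)
      let v₁ : Formula S σ := t₁.val (k + 4) (.int I)
      let v₂ : Formula S σ := t₂.val (k + 4) (.int J)
      -- `I` divided by `J` gives the quotient `K`, rounded down, and the remainder `R`
      let isDiv : Formula S σ := .bigAnd
        [.cmp .eq (.int I) (.int (.add (.mul J K) R)), v₁, v₂, .cmp .ne (.int J) (.int (.num 0)),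
         .or (.and (.cmp .le (.int (.num 0)) (.int R)) (.cmp .lt (.int R) (.int J)))
             (.and (.cmp .lt (.int J) (.int R)) (.cmp .le (.int R) (.int (.num 0))))]
      match o with
      | .add => .exI k (.exI (k + 1) (.bigAnd [.cmp .eq Z (.int (.add I J)), v₁, v₂]))
      | .sub => .exI k (.exI (k + 1) (.bigAnd [.cmp .eq Z (.int (.sub I J)), v₁, v₂]))
      | .mul => .exI k (.exI (k + 1) (.bigAnd [.cmp .eq Z (.int (.mul I J)), v₁, v₂]))
      | .div => .exI k (.exI (k + 1) (.exI (k + 2) (.exI (k + 3)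
          (.and isDiv (.cmp .eq Z (.int K))))))
      | .mod => .exI k (.exI (k + 1) (.exI (k + 2) (.exI (k + 3)
          (.and isDiv (.cmp .eq Z (.int R))))))
      | .interval => .exI k (.exI (k + 1) (.exI (k + 2) (.bigAnd
          [v₁, v₂, .cmp .le (.int I) (.int K), .cmp .le (.int K) (.int J),
           .cmp .eq Z (.int K)])))

/-- The formula `val_t(Z)` for a tuple of terms and a tuple of general variables. -/
def valTuple {S : Type} {σ : Signature} (ts : List (MTerm S)) (Z : List ℕ) : Formula S σ :=
  .bigAnd (List.zipWith (fun t z => t.val 0 (.var z)) ts Z)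

/-- A literal of the given sign. -/
def Sign.applyF {S : Type} {σ : Signature} : Sign → Formula S σ → Formula S σ
  | .pos, F => F
  | .neg, F => F.neg
  | .negneg, F => F.neg.neg

/-- The translation `τ^B` of literals and comparisons. -/
def Basic.tauB {S : Type} : Basic S → Formula S (sigma0 S)
  | .lit s p ts =>
      let Z := freshList (above (ts.flatMap MTerm.vars)) ts.length
      .exsG Z (.and (valTuple ts Z) (s.applyF (atomF p (Z.map GTerm.var))))
  | .cmp c t₁ t₂ =>
      let z := above (t₁.vars ++ t₂.vars)
      .exsG [z, z + 1] (.bigAnd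
        [t₁.val 0 (.var z), t₂.val 0 (.var (z + 1)), .cmp c (.var z) (.var (z + 1))])

/-- The translation `τ^B` of conjunctions of literals and comparisons. -/
def conjTauB {S : Type} (L : List (Basic S)) : Formula S (sigma0 S) :=
  .bigAnd (L.map Basic.tauB)

section FreeVariables

theorem Formula.freeG_bigAnd {S : Type} {σ : Signature} {x : ℕ} :
    ∀ {l : List (Formula S σ)}, (Formula.bigAnd l).FreeG x → ∃ F ∈ l, F.FreeG x
  | [], h => by simp [bigAnd, top, FreeG] at h
  | [F], h => ⟨F, by simp, h⟩
  | F :: G :: l, h => by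
      rcases h with h | h
      · exact ⟨F, by simp, h⟩
      · obtain ⟨F', hF', hx⟩ := Formula.freeG_bigAnd h
        exact ⟨F', List.mem_cons_of_mem _ hF', hx⟩

theorem Formula.freeI_bigAnd {S : Type} {σ : Signature} {n : ℕ} :
    ∀ {l : List (Formula S σ)}, (Formula.bigAnd l).FreeI n → ∃ F ∈ l, F.FreeI n
  | [], h => by simp [bigAnd, top, FreeI] at h
  | [F], h => ⟨F, by simp, h⟩
  | F :: G :: l, h => by
      rcases h with h | h
      · exact ⟨F, by simp, h⟩
      · obtain ⟨F', hF', hx⟩ := Formula.freeI_bigAnd h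
        exact ⟨F', List.mem_cons_of_mem _ hF', hx⟩

theorem Formula.freeG_exsG {S : Type} {σ : Signature} {x : ℕ} {F : Formula S σ} :
    ∀ {l : List ℕ}, (Formula.exsG l F).FreeG x → x ∉ l ∧ F.FreeG x
  | [], h => ⟨by simp, h⟩
  | y :: l, h => by
      have h' : x ≠ y ∧ (Formula.exsG l F).FreeG x := h
      obtain ⟨h₁, h₂⟩ := Formula.freeG_exsG h'.2
      exact ⟨by simp [h'.1, h₁], h₂⟩

theorem Formula.freeI_exsG {S : Type} {σ : Signature} {n : ℕ} {F : Formula S σ} {l : List ℕ}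
    (h : (Formula.exsG l F).FreeI n) : F.FreeI n := by
  induction l with
  | nil => exact h
  | cons _ _ ih => exact ih h

theorem MTerm.freeG_val {S : Type} {σ : Signature} {x : ℕ} :
    ∀ {t : MTerm S} {k : ℕ} {Z : GTerm S},
      (t.val k Z : Formula S σ).FreeG x → x ∈ t.vars ∨ Z.OccG x
  | .pre r, _, _, h => by
      cases r <;> simpa [val, Formula.FreeG, PTerm.toGTerm, GTerm.OccG, vars] using h
  | .var y, _, _, h => by
      have h' := h
      simp only [val, Formula.FreeG, GTerm.OccG, vars, List.mem_singleton] at h' ⊢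
      rcases h' with h' | h'
      · exact Or.inr h'
      · exact Or.inl h'.symm
  | .op o t₁ t₂, k, Z, h => by
      have h₁ : ∀ n, (t₁.val (k + 4) (.int n) : Formula S σ).FreeG x → x ∈ t₁.vars := fun n h =>
        (MTerm.freeG_val h).resolve_right (by simp [GTerm.OccG])
      have h₂ : ∀ n, (t₂.val (k + 4) (.int n) : Formula S σ).FreeG x → x ∈ t₂.vars := fun n h =>
        (MTerm.freeG_val h).resolve_right (by simp [GTerm.OccG])
      have h₁' := h₁ (.var k)
      have h₂' := h₂ (.var (k + 1))
      cases o <;>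
        simp only [val, Formula.bigAnd, Formula.FreeG, GTerm.OccG, vars, List.mem_append] at h ⊢ <;>
        tauto

theorem MTerm.freeI_val {S : Type} {σ : Signature} {n : ℕ} :
    ∀ {t : MTerm S} {k : ℕ} {Z : GTerm S}, (t.val k Z : Formula S σ).FreeI n → Z.OccI n
  | .pre r, _, _, h => by
      cases r <;> simpa [val, Formula.FreeI, PTerm.toGTerm, GTerm.OccI, ITerm.OccI] using h
  | .var y, _, _, h => by
      simpa [val, Formula.FreeI, GTerm.OccI] using h
  | .op o t₁ t₂, k, Z, h => by
      have h₁ : (t₁.val (k + 4) (.int (.var k)) : Formula S σ).FreeI n → n = k := fun h => by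
        simpa [GTerm.OccI, ITerm.OccI, eq_comm] using MTerm.freeI_val h
      have h₂ : (t₂.val (k + 4) (.int (.var (k + 1))) : Formula S σ).FreeI n → n = k + 1 :=
        fun h => by simpa [GTerm.OccI, ITerm.OccI, eq_comm] using MTerm.freeI_val h
      cases o <;>
        simp only [val, Formula.bigAnd, Formula.FreeI, GTerm.OccI, ITerm.OccI] at h ⊢ <;>
        grind

theorem freeG_valTuple {S : Type} {σ : Signature} {x : ℕ} {ts : List (MTerm S)} {Z : List ℕ}
    (h : (valTuple ts Z : Formula S σ).FreeG x) : x ∈ ts.flatMap MTerm.vars ∨ x ∈ Z := by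
  obtain ⟨F, hF, hx⟩ := Formula.freeG_bigAnd h
  obtain ⟨i, hi, rfl⟩ := List.getElem_of_mem hF
  rw [List.getElem_zipWith] at hx
  rcases MTerm.freeG_val hx with h' | h'
  · exact Or.inl (List.mem_flatMap.2 ⟨_, List.getElem_mem _, h'⟩)
  · have h'' : Z[i]'(by simp at hi; omega) = x := h'
    exact Or.inr (h'' ▸ List.getElem_mem _)

theorem freeI_valTuple {S : Type} {σ : Signature} {n : ℕ} {ts : List (MTerm S)} {Z : List ℕ} :
    ¬ (valTuple ts Z : Formula S σ).FreeI n := by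
  intro h
  obtain ⟨F, hF, hx⟩ := Formula.freeI_bigAnd h
  obtain ⟨i, hi, rfl⟩ := List.getElem_of_mem hF
  rw [List.getElem_zipWith] at hx
  exact MTerm.freeI_val hx

theorem Basic.freeG_tauB {S : Type} {x : ℕ} :
    ∀ {B : Basic S}, B.tauB.FreeG x → x ∈ B.vars
  | .lit s p ts, h => by
      obtain ⟨hx, h⟩ := Formula.freeG_exsG h
      rcases h with h | h
      · exact (freeG_valTuple h).resolve_right hx
      · have h' : (atomF p ((freshList (above (ts.flatMap MTerm.vars)) ts.length).map
            GTerm.var)).FreeG x := by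
          cases s <;> simpa [Sign.applyF, Formula.neg, Formula.FreeG] using h
        obtain ⟨i, hi⟩ := h'
        obtain ⟨z, hz, hz'⟩ := List.mem_map.1 (List.get_mem _ i)
        rw [← hz'] at hi
        have hzx : z = x := hi
        exact absurd (hzx ▸ hz) hx
  | .cmp c t₁ t₂, h => by
      obtain ⟨hx, h⟩ := Formula.freeG_exsG h
      simp only [List.mem_cons, List.not_mem_nil, or_false, not_or] at hx
      simp only [Formula.bigAnd, Formula.FreeG, GTerm.OccG] at h
      rcases h with h | h | h | h
      · exact List.mem_append_left _ ((MTerm.freeG_val h).resolve_right fun e => hx.1 (Eq.symm e))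
      · exact List.mem_append_right _ ((MTerm.freeG_val h).resolve_right fun e => hx.2 (Eq.symm e))
      · exact absurd h.symm hx.1
      · exact absurd h.symm hx.2

theorem Basic.freeI_tauB {S : Type} {n : ℕ} : ∀ {B : Basic S}, ¬ B.tauB.FreeI n
  | .lit s p ts, h => by
      have h := Formula.freeI_exsG h
      rcases h with h | h
      · exact freeI_valTuple h
      · have h' : (atomF p ((freshList (above (ts.flatMap MTerm.vars)) ts.length).map
            GTerm.var)).FreeI n := by
          cases s <;> simpa [Sign.applyF, Formula.neg, Formula.FreeI] using h
        obtain ⟨i, hi⟩ := h'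
        obtain ⟨z, hz, hz'⟩ := List.mem_map.1 (List.get_mem _ i)
        rw [← hz'] at hi
        exact hi
  | .cmp c t₁ t₂, h => by
      have h := Formula.freeI_exsG h
      simp only [Formula.bigAnd, Formula.FreeI, GTerm.OccI, or_self, or_false] at h
      rcases h with h | h
      · exact MTerm.freeI_val h
      · exact MTerm.freeI_val h

end FreeVariables

/-- The predicate constant used to represent an aggregate atom `count{X : L} ≥ t` or
`count{X : L} ≤ t` in the body of a rule with the list `glob` of global variables: `V` is the list
of global variables that occur in `L`, and the subscript is `∃W τ^B(L)`, where `W` is the list of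
local variables that occur in `L` and are not included in `X`. (In a pure rule, no member of `X` is
global, so that the exclusion of `X` in the definition of `V` has no effect.) -/
def AggElem.countPred {S : Type} (E : AggElem S) (rel : CountRel) (glob : List ℕ) :
    CountPred S where
  rel := rel
  X := E.X
  V := (conjVars E.L).dedup.filter fun v => v ∈ glob ∧ v ∉ E.X
  F := .exsG ((conjVars E.L).dedup.filter fun v => v ∉ glob ∧ v ∉ E.X) (conjTauB E.L)
  nodup_X := E.nodup
  nodup_V := (List.nodup_dedup _).filter _
  disjoint := by
    intro x hx hx'
    simp [hx] at hx'
  freeG := by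
    intro x hx
    obtain ⟨hx, h⟩ := Formula.freeG_exsG hx
    obtain ⟨F, hF, hxF⟩ := Formula.freeG_bigAnd h
    obtain ⟨B, hB, rfl⟩ := List.mem_map.1 hF
    have hL : x ∈ conjVars E.L := List.mem_flatMap.2 ⟨B, hB, Basic.freeG_tauB hxF⟩
    simp only [List.mem_filter, List.mem_dedup, hL, true_and, decide_eq_true_eq] at hx ⊢
    tauto
  freeI := by
    intro n h
    obtain ⟨F, hF, hnF⟩ := Formula.freeI_bigAnd (Formula.freeI_exsG h)
    obtain ⟨B, hB, rfl⟩ := List.mem_map.1 hF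
    exact Basic.freeI_tauB hnF

/-- The formula `B*` for a member `B` of the body of a rule with the list `glob` of global
variables. -/
def BodyElem.star {S : Type} (glob : List ℕ) : BodyElem S → Formula S (sigma1 S)
  | .basic B => B.tauB.toSigma1
  | .count rel E t _ =>
      let c := above (t.vars ++ conjVars E.L)
      .exG c (.and (t.val 0 (.var c)) ((E.countPred rel glob).app (.var c)))

/-- The sentence `τ*(R)`. -/
def Rule.tauStar {S : Type} (R : Rule S) : Formula S (sigma1 S) :=
  let body := R.body.map (BodyElem.star R.globals)
  match R.head with
  | .atom p ts =>
      let Z := freshList (above R.globals) ts.length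
      .allsG (R.globals ++ Z) (.imp (.bigAnd (body ++ [valTuple ts Z]))
        (atomF p (Z.map GTerm.var)).toSigma1)
  | .choice p ts =>
      let Z := freshList (above R.globals) ts.length
      let A := (atomF p (Z.map GTerm.var)).toSigma1
      .allsG (R.globals ++ Z) (.imp (.bigAnd (body ++ [valTuple ts Z])) (.or A A.neg))
  | .empty => .allsG R.globals (Formula.bigAnd body).neg

/-- The sentence `τ*(Π)`. -/
def Program.tauStar {S : Type} (P : Program S) : Formula S (sigma1 S) :=
  .bigAnd (P.rules.map Rule.tauStar)

/-! ## The logic of here-and-there with arithmetic -/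

/-- The value of an integer term under an assignment of integers to integer variables. -/
def ITerm.eval (ρ : ℕ → ℤ) : ITerm → ℤ
  | .num n => n
  | .var n => ρ n
  | .add t₁ t₂ => t₁.eval ρ + t₂.eval ρ
  | .sub t₁ t₂ => t₁.eval ρ - t₂.eval ρ
  | .mul t₁ t₂ => t₁.eval ρ * t₂.eval ρ

/-- The value of a general term under an assignment of values to variables. -/
def GTerm.eval {S : Type} (g : ℕ → PTerm S) (ρ : ℕ → ℤ) : GTerm S → PTerm S
  | .int t => .num (t.eval ρ)
  | .inf => .inf
  | .sym s => .sym s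
  | .sup => .sup
  | .var x => g x

namespace Formula

/-- The formula contains no predicate constants other than comparison symbols. -/
def Arithmetical {S : Type} {σ : Signature} : Formula S σ → Prop
  | bot => True
  | pred _ _ => False
  | cmp _ _ _ => True
  | and F G => F.Arithmetical ∧ G.Arithmetical
  | or F G => F.Arithmetical ∧ G.Arithmetical
  | imp F G => F.Arithmetical ∧ G.Arithmetical
  | allG _ F => F.Arithmetical
  | exG _ F => F.Arithmetical
  | allI _ F => F.Arithmetical
  | exI _ F => F.Arithmetical

/-- Classical truth, under an assignment of values to variables, of a formula containing no
predicate constants other than comparison symbols: general variables range over precomputed terms,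
integer variables over integers, and the other symbols have their standard meaning. (The clause
for predicate constants is irrelevant.) -/
def Holds {S : Type} [PrecomputedOrder S] {σ : Signature} :
    Formula S σ → (ℕ → PTerm S) → (ℕ → ℤ) → Prop
  | bot, _, _ => False
  | pred _ _, _, _ => False
  | cmp c t₁ t₂, g, ρ => c.Holds (t₁.eval g ρ) (t₂.eval g ρ)
  | and F G, g, ρ => F.Holds g ρ ∧ G.Holds g ρ
  | or F G, g, ρ => F.Holds g ρ ∨ G.Holds g ρ
  | imp F G, g, ρ => F.Holds g ρ → G.Holds g ρ
  | allG x F, g, ρ => ∀ r, F.Holds (Function.update g x r) ρ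
  | exG x F, g, ρ => ∃ r, F.Holds (Function.update g x r) ρ
  | allI n F, g, ρ => ∀ m, F.Holds g (Function.update ρ n m)
  | exI n F, g, ρ => ∃ m, F.Holds g (Function.update ρ n m)

end Formula

/-- The postulates, beyond intuitionistic logic with equality, of the logic of here-and-there with arithmetic. -/
inductive HTASchema {S : Type} [PrecomputedOrder S] {σ : Signature} : Formula S σ → Prop where
  /-- `F ∨ (F → G) ∨ ¬G` -/
  | hosoi (F G : Formula S σ) : HTASchema (.or F (.or (.imp F G) G.neg))
  /-- `∃X(F → ∀X F)` for general variables -/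
  | sqhtG (x : ℕ) (F : Formula S σ) : HTASchema (.exG x (.imp F (.allG x F)))
  /-- `∃N(F → ∀N F)` for integer variables -/
  | sqhtI (n : ℕ) (F : Formula S σ) : HTASchema (.exI n (.imp F (.allI n F)))
  /-- all true formulas about precomputed terms, comparisons and arithmetic operations; among them
  are decidability of equality and of the other comparisons -/
  | std (F : Formula S σ) (hF : F.Arithmetical) (h : ∀ g ρ, F.Holds g ρ) : HTASchema F
  /-- induction: `F(0) ∧ ∀N(N ≥ 0 ∧ F(N) → F(N + 1)) → ∀N(N ≥ 0 → F(N))` -/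
  | induction (n : ℕ) (F : Formula S σ) :
      HTASchema (.imp
        (.and (F.subst (.singleI n (.num 0)))
          (.allI n (.imp (.and (.cmp .ge (.int (.var n)) (.int (.num 0))) F)
            (F.subst (.singleI n (.add (.var n) (.num 1)))))))
        (.allI n (.imp (.cmp .ge (.int (.var n)) (.int (.num 0))) F)))

/-- `HTA Ax Γ F` expresses that the sequent `Γ ⇒ F` is derivable in the logic of here-and-there
with arithmetic extended by the set `Ax` of axioms: natural deduction for two-sorted intuitionistic
predicate logic with equality, with additional postulates. -/
inductive HTA {S : Type} [PrecomputedOrder S] {σ : Signature} (Ax : Set (Formula S σ)) :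
    List (Formula S σ) → Formula S σ → Prop where
  | hyp {Γ F} : F ∈ Γ → HTA Ax Γ F
  | ax {Γ F} : F ∈ Ax → HTA Ax Γ F
  | schema {Γ F} : HTASchema F → HTA Ax Γ F
  | weaken {Γ Δ F} : Γ ⊆ Δ → HTA Ax Γ F → HTA Ax Δ F
  | botE {Γ F} : HTA Ax Γ .bot → HTA Ax Γ F
  | andI {Γ F G} : HTA Ax Γ F → HTA Ax Γ G → HTA Ax Γ (.and F G)
  | andE₁ {Γ F G} : HTA Ax Γ (.and F G) → HTA Ax Γ F
  | andE₂ {Γ F G} : HTA Ax Γ (.and F G) → HTA Ax Γ G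
  | orI₁ {Γ F G} : HTA Ax Γ F → HTA Ax Γ (.or F G)
  | orI₂ {Γ F G} : HTA Ax Γ G → HTA Ax Γ (.or F G)
  | orE {Γ F G H} : HTA Ax Γ (.or F G) → HTA Ax (F :: Γ) H → HTA Ax (G :: Γ) H → HTA Ax Γ H
  | impI {Γ F G} : HTA Ax (F :: Γ) G → HTA Ax Γ (.imp F G)
  | impE {Γ F G} : HTA Ax Γ F → HTA Ax Γ (.imp F G) → HTA Ax Γ G
  | allGI {Γ F x} : (∀ G ∈ Γ, ¬ G.FreeG x) → HTA Ax Γ F → HTA Ax Γ (.allG x F)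
  | allGE {Γ F x} (t : GTerm S) : F.FreeFor (.singleG x t) → HTA Ax Γ (.allG x F) →
      HTA Ax Γ (F.subst (.singleG x t))
  | exGI {Γ F x} (t : GTerm S) : F.FreeFor (.singleG x t) → HTA Ax Γ (F.subst (.singleG x t)) →
      HTA Ax Γ (.exG x F)
  | exGE {Γ F G x} : (∀ H ∈ Γ, ¬ H.FreeG x) → ¬ G.FreeG x → HTA Ax Γ (.exG x F) →
      HTA Ax (F :: Γ) G → HTA Ax Γ G
  | allII {Γ F n} : (∀ G ∈ Γ, ¬ G.FreeI n) → HTA Ax Γ F → HTA Ax Γ (.allI n F)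
  | allIE {Γ F n} (t : ITerm) : F.FreeFor (.singleI n t) → HTA Ax Γ (.allI n F) →
      HTA Ax Γ (F.subst (.singleI n t))
  | exII {Γ F n} (t : ITerm) : F.FreeFor (.singleI n t) → HTA Ax Γ (F.subst (.singleI n t)) →
      HTA Ax Γ (.exI n F)
  | exIE {Γ F G n} : (∀ H ∈ Γ, ¬ H.FreeI n) → ¬ G.FreeI n → HTA Ax Γ (.exI n F) →
      HTA Ax (F :: Γ) G → HTA Ax Γ G
  | eqRefl {Γ} (t : GTerm S) : HTA Ax Γ (.cmp .eq t t)
  | eqSubstG {Γ} {F : Formula S σ} {x} (t₁ t₂ : GTerm S) : F.FreeFor (.singleG x t₁) → F.FreeFor (.singleG x t₂) →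
      HTA Ax Γ (.cmp .eq t₁ t₂) → HTA Ax Γ (F.subst (.singleG x t₁)) →
      HTA Ax Γ (F.subst (.singleG x t₂))
  | eqSubstI {Γ} {F : Formula S σ} {n} (t₁ t₂ : ITerm) : F.FreeFor (.singleI n t₁) → F.FreeFor (.singleI n t₂) →
      HTA Ax Γ (.cmp .eq (.int t₁) (.int t₂)) → HTA Ax Γ (F.subst (.singleI n t₁)) →
      HTA Ax Γ (F.subst (.singleI n t₂))

/-- Formulas `F` and `G` are equivalent in the logic of here-and-there with arithmetic extended by
the axioms `Ax`: the formula `F ↔ G` is derivable. -/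
def HTAEquivalent {S : Type} [PrecomputedOrder S] {σ : Signature} (Ax : Set (Formula S σ))
    (F G : Formula S σ) : Prop :=
  HTA Ax [] (.iff F G)

end MGC

/-!
The proof is semantic. A pair `J ⊆ I` of sets of precomputed atoms is a here-and-there
interpretation, and it interprets both infinitary propositional formulas (`InfFormula.HT`) and
two-sorted first-order formulas over the standard domains of precomputed terms and integers
(`Formula.Force`).

On the propositional side, `J` satisfies the reduct of a formula relative to `I` if and only if the
formula holds in `⟨J, I⟩` (`InfFormula.sat_reduct_iff_ht`), so that formulas with the same
here-and-there models are strongly equivalent (`InfFormula.stronglyEquivalent_of_ht`).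

On the first-order side, `interp₁` extends `⟨J, I⟩` to the signature `σ₁` by interpreting `Atleast`
and `Atmost` as cardinality bounds on the set of tuples satisfying the subscript. The axioms `Defs`
hold in these interpretations (`force_of_mem_Defs`), and every formula derivable in the logic of
here-and-there with arithmetic from axioms that hold in an interpretation holds in it as well
(`HTA.force`).

The two sides are linked by `Program.force_tauStar`: the sentence `τ*(Π)` holds in the first-order
interpretation determined by `⟨J, I⟩` if and only if `τ(Π)` holds in `⟨J, I⟩`. It follows that
`τ(Π₁)` and `τ(Π₂)` have the same here-and-there models whenever `τ*(Π₁) ↔ τ*(Π₂)` is derivable.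
-/

namespace MGC

/-! ### Here-and-there semantics of two-sorted formulas -/

/-- A set of ground atomic formulas: the extents of all predicate constants of `σ` over the standard
domain of precomputed terms. -/
abbrev Interp (S : Type) (σ : Signature) : Type :=
  (q : σ.Pred) → (Fin (σ.arity q) → PTerm S) → Prop

/-- Satisfaction of a formula in the here-and-there interpretation with the "here" part `H` and the
"there" part `T`, over the standard domains. Classical satisfaction in `T` is the case `H = T`. -/
def Formula.Force {S : Type} [PrecomputedOrder S] {σ : Signature} :
    Formula S σ → Interp S σ → Interp S σ → (ℕ → PTerm S) → (ℕ → ℤ) → Prop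
  | bot, _, _, _, _ => False
  | pred q ts, H, _, g, ρ => H q fun i => (ts i).eval g ρ
  | cmp c t₁ t₂, _, _, g, ρ => c.Holds (t₁.eval g ρ) (t₂.eval g ρ)
  | and F G, H, T, g, ρ => F.Force H T g ρ ∧ G.Force H T g ρ
  | or F G, H, T, g, ρ => F.Force H T g ρ ∨ G.Force H T g ρ
  | imp F G, H, T, g, ρ =>
      (F.Force H T g ρ → G.Force H T g ρ) ∧ (F.Force T T g ρ → G.Force T T g ρ)
  | allG x F, H, T, g, ρ => ∀ r, F.Force H T (Function.update g x r) ρ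
  | exG x F, H, T, g, ρ => ∃ r, F.Force H T (Function.update g x r) ρ
  | allI n F, H, T, g, ρ => ∀ m, F.Force H T g (Function.update ρ n m)
  | exI n F, H, T, g, ρ => ∃ m, F.Force H T g (Function.update ρ n m)

section Terms

variable {S : Type}

theorem ITerm.eval_congr {ρ ρ' : ℕ → ℤ} :
    ∀ {t : ITerm}, (∀ n, t.OccI n → ρ n = ρ' n) → t.eval ρ = t.eval ρ'
  | .num _, _ => rfl
  | .var n, h => h n rfl
  | .add t₁ t₂, h => by
      rw [eval, eval, eval_congr fun n hn => h n (.inl hn), eval_congr fun n hn => h n (.inr hn)]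
  | .sub t₁ t₂, h => by
      rw [eval, eval, eval_congr fun n hn => h n (.inl hn), eval_congr fun n hn => h n (.inr hn)]
  | .mul t₁ t₂, h => by
      rw [eval, eval, eval_congr fun n hn => h n (.inl hn), eval_congr fun n hn => h n (.inr hn)]

theorem GTerm.eval_congr {g g' : ℕ → PTerm S} {ρ ρ' : ℕ → ℤ} {t : GTerm S}
    (hg : ∀ x, t.OccG x → g x = g' x) (hρ : ∀ n, t.OccI n → ρ n = ρ' n) :
    t.eval g ρ = t.eval g' ρ' := by
  cases t with
  | int t => exact congrArg PTerm.num (ITerm.eval_congr hρ)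
  | var x => exact hg x rfl
  | _ => rfl

theorem ITerm.eval_subst (θ : ℕ → ITerm) (ρ : ℕ → ℤ) (t : ITerm) :
    (t.subst θ).eval ρ = t.eval fun n => (θ n).eval ρ := by
  induction t <;> simp_all [subst, eval]

theorem GTerm.eval_subst (θ : Subst S) (g : ℕ → PTerm S) (ρ : ℕ → ℤ) (t : GTerm S) :
    (t.subst θ).eval g ρ = t.eval (fun x => (θ.g x).eval g ρ) fun n => (θ.i n).eval ρ := by
  cases t <;> simp [subst, eval, ITerm.eval_subst]

theorem GTerm.eval_int (g : ℕ → PTerm S) (ρ : ℕ → ℤ) (t : ITerm) :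
    (GTerm.int t).eval g ρ = .num (t.eval ρ) := rfl

theorem GTerm.eval_var (g : ℕ → PTerm S) (ρ : ℕ → ℤ) (x : ℕ) : (GTerm.var x).eval g ρ = g x := rfl

@[simp] theorem PTerm.eval_toGTerm (g : ℕ → PTerm S) (ρ : ℕ → ℤ) (r : PTerm S) :
    r.toGTerm.eval g ρ = r := by
  cases r <;> rfl

end Terms

namespace Formula

variable {S : Type} [PrecomputedOrder S] {σ : Signature}

/-- Persistence: what holds here holds there. -/
theorem Force.mono {H T : Interp S σ} (hHT : ∀ q a, H q a → T q a) :
    ∀ {F : Formula S σ} {g ρ}, F.Force H T g ρ → F.Force T T g ρ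
  | bot, _, _, h => h
  | pred q _, _, _, h => hHT q _ h
  | cmp _ _ _, _, _, h => h
  | and _ _, _, _, h => ⟨h.1.mono hHT, h.2.mono hHT⟩
  | or _ _, _, _, h => h.imp (Force.mono hHT) (Force.mono hHT)
  | imp _ _, _, _, h => ⟨h.2, h.2⟩
  | allG _ _, _, _, h => fun r => (h r).mono hHT
  | exG _ _, _, _, ⟨r, h⟩ => ⟨r, h.mono hHT⟩
  | allI _ _, _, _, h => fun m => (h m).mono hHT
  | exI _ _, _, _, ⟨m, h⟩ => ⟨m, h.mono hHT⟩

/-- Satisfaction depends only on the values of free variables. -/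
theorem force_congr {F : Formula S σ} : ∀ {H T : Interp S σ} {g g' : ℕ → PTerm S} {ρ ρ' : ℕ → ℤ},
    (∀ x, F.FreeG x → g x = g' x) → (∀ n, F.FreeI n → ρ n = ρ' n) →
    (F.Force H T g ρ ↔ F.Force H T g' ρ') := by
  induction F with
  | bot => intros; rfl
  | pred q ts =>
      intro H T g g' ρ ρ' hg hρ
      have : ∀ i, (ts i).eval g ρ = (ts i).eval g' ρ' := fun i =>
        GTerm.eval_congr (fun x hx => hg x ⟨i, hx⟩) fun n hn => hρ n ⟨i, hn⟩
      simp only [Force, this]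
  | cmp c t₁ t₂ =>
      intro H T g g' ρ ρ' hg hρ
      simp only [Force]
      rw [GTerm.eval_congr (t := t₁) (fun x hx => hg x (.inl hx)) fun n hn => hρ n (.inl hn),
        GTerm.eval_congr (t := t₂) (fun x hx => hg x (.inr hx)) fun n hn => hρ n (.inr hn)]
  | and F G ihF ihG =>
      intro H T g g' ρ ρ' hg hρ
      exact and_congr (ihF (fun x hx => hg x (.inl hx)) fun n hn => hρ n (.inl hn))
        (ihG (fun x hx => hg x (.inr hx)) fun n hn => hρ n (.inr hn))
  | or F G ihF ihG =>
      intro H T g g' ρ ρ' hg hρ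
      exact or_congr (ihF (fun x hx => hg x (.inl hx)) fun n hn => hρ n (.inl hn))
        (ihG (fun x hx => hg x (.inr hx)) fun n hn => hρ n (.inr hn))
  | imp F G ihF ihG =>
      intro H T g g' ρ ρ' hg hρ
      have hF := fun H : Interp S σ => ihF (H := H) (T := T) (fun x hx => hg x (.inl hx))
        fun n hn => hρ n (.inl hn)
      have hG := fun H : Interp S σ => ihG (H := H) (T := T) (fun x hx => hg x (.inr hx))
        fun n hn => hρ n (.inr hn)
      exact and_congr (imp_congr (hF H) (hG H)) (imp_congr (hF T) (hG T))
  | allG x F ih =>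
      intro H T g g' ρ ρ' hg hρ
      refine forall_congr' fun r => ih (fun y hy => ?_) hρ
      by_cases h : y = x
      · simp [h]
      · simp [h, hg y ⟨h, hy⟩]
  | exG x F ih =>
      intro H T g g' ρ ρ' hg hρ
      refine exists_congr fun r => ih (fun y hy => ?_) hρ
      by_cases h : y = x
      · simp [h]
      · simp [h, hg y ⟨h, hy⟩]
  | allI x F ih =>
      intro H T g g' ρ ρ' hg hρ
      refine forall_congr' fun r => ih hg (fun y hy => ?_)
      by_cases h : y = x
      · simp [h]
      · simp [h, hρ y ⟨h, hy⟩]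
  | exI x F ih =>
      intro H T g g' ρ ρ' hg hρ
      refine exists_congr fun r => ih hg (fun y hy => ?_)
      by_cases h : y = x
      · simp [h]
      · simp [h, hρ y ⟨h, hy⟩]

omit [PrecomputedOrder S] in
theorem eval_keepG {F : Formula S σ} {θ : Subst S} {x : ℕ} (hθ : F.AvoidsG θ x)
    (g : ℕ → PTerm S) (ρ : ℕ → ℤ) (r : PTerm S) {y : ℕ} (hy : F.FreeG y) :
    ((θ.keepG x).g y).eval (Function.update g x r) ρ =
      Function.update (fun y => (θ.g y).eval g ρ) x r y := by
  by_cases h : y = x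
  · subst h; simp [Subst.keepG, GTerm.eval]
  · simp only [Subst.keepG, Function.update_of_ne h]
    refine GTerm.eval_congr (fun z hz => ?_) fun _ _ => rfl
    have : z ≠ x := fun e => hθ y h hy (e ▸ hz)
    simp [this]

omit [PrecomputedOrder S] in
theorem eval_keepI_i {F : Formula S σ} {θ : Subst S} {n : ℕ} (hθ : F.AvoidsI θ n)
    (ρ : ℕ → ℤ) (m : ℤ) {k : ℕ} (hk : F.FreeI k) :
    ((θ.keepI n).i k).eval (Function.update ρ n m) =
      Function.update (fun k => (θ.i k).eval ρ) n m k := by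
  by_cases h : k = n
  · subst h; simp [Subst.keepI, ITerm.eval]
  · simp only [Subst.keepI, Function.update_of_ne h]
    refine ITerm.eval_congr fun z hz => ?_
    have : z ≠ n := fun e => hθ.2 k h hk (e ▸ hz)
    simp [this]

omit [PrecomputedOrder S] in
theorem eval_keepI_g {F : Formula S σ} {θ : Subst S} {n : ℕ} (hθ : F.AvoidsI θ n)
    (g : ℕ → PTerm S) (ρ : ℕ → ℤ) (m : ℤ) {y : ℕ} (hy : F.FreeG y) :
    ((θ.keepI n).g y).eval g (Function.update ρ n m) = (θ.g y).eval g ρ := by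
  refine GTerm.eval_congr (fun _ _ => rfl) fun z hz => ?_
  have : z ≠ n := fun e => hθ.1 y hy (e ▸ hz)
  simp [this]

/-- The substitution lemma. -/
theorem force_subst {F : Formula S σ} : ∀ {θ : Subst S}, F.FreeFor θ →
    ∀ {H T : Interp S σ} {g : ℕ → PTerm S} {ρ : ℕ → ℤ},
    ((F.subst θ).Force H T g ρ ↔
      F.Force H T (fun x => (θ.g x).eval g ρ) fun n => (θ.i n).eval ρ) := by
  induction F with
  | bot => intros; rfl
  | pred q ts => intros; simp only [subst, Force, GTerm.eval_subst]
  | cmp c t₁ t₂ => intros; simp only [subst, Force, GTerm.eval_subst]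
  | and F G ihF ihG => intro θ hθ H T g ρ; exact and_congr (ihF hθ.1) (ihG hθ.2)
  | or F G ihF ihG => intro θ hθ H T g ρ; exact or_congr (ihF hθ.1) (ihG hθ.2)
  | imp F G ihF ihG =>
      intro θ hθ H T g ρ
      exact and_congr (imp_congr (ihF hθ.1) (ihG hθ.2)) (imp_congr (ihF hθ.1) (ihG hθ.2))
  | allG x F ih =>
      intro θ hθ H T g ρ
      exact forall_congr' fun r => (ih hθ.2).trans
        (force_congr (fun y hy => eval_keepG hθ.1 g ρ r hy) fun _ _ => rfl)
  | exG x F ih =>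
      intro θ hθ H T g ρ
      exact exists_congr fun r => (ih hθ.2).trans
        (force_congr (fun y hy => eval_keepG hθ.1 g ρ r hy) fun _ _ => rfl)
  | allI n F ih =>
      intro θ hθ H T g ρ
      exact forall_congr' fun m => (ih hθ.2).trans
        (force_congr (fun y hy => eval_keepI_g hθ.1 g ρ m hy) fun k hk => eval_keepI_i hθ.1 ρ m hk)
  | exI n F ih =>
      intro θ hθ H T g ρ
      exact exists_congr fun m => (ih hθ.2).trans
        (force_congr (fun y hy => eval_keepI_g hθ.1 g ρ m hy) fun k hk => eval_keepI_i hθ.1 ρ m hk)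

theorem force_singleG {F : Formula S σ} {x : ℕ} {t : GTerm S} (h : F.FreeFor (.singleG x t))
    {H T : Interp S σ} {g : ℕ → PTerm S} {ρ : ℕ → ℤ} :
    (F.subst (.singleG x t)).Force H T g ρ ↔
      F.Force H T (Function.update g x (t.eval g ρ)) ρ := by
  rw [force_subst h]
  refine force_congr (fun y _ => ?_) fun _ _ => rfl
  by_cases e : y = x
  · subst e; simp [Subst.singleG]
  · simp [Subst.singleG, e, GTerm.eval]

theorem force_singleI {F : Formula S σ} {n : ℕ} {t : ITerm} (h : F.FreeFor (.singleI n t))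
    {H T : Interp S σ} {g : ℕ → PTerm S} {ρ : ℕ → ℤ} :
    (F.subst (.singleI n t)).Force H T g ρ ↔
      F.Force H T g (Function.update ρ n (t.eval ρ)) := by
  rw [force_subst h]
  refine force_congr (fun _ _ => rfl) fun y _ => ?_
  by_cases e : y = n
  · subst e; simp [Subst.singleI]
  · simp [Subst.singleI, e, ITerm.eval]

omit [PrecomputedOrder S] in
/-- A substitution is free for `F` if all variables that it introduces are greater than all general
variables of `F`. -/
theorem freeFor_of_fresh {F : Formula S σ} : ∀ {θ : Subst S},
    (∀ x y, (θ.g x).OccG y → y = x ∨ F.freshG ≤ y) → (∀ x n, ¬ (θ.g x).OccI n) →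
    (∀ n m, (θ.i n).OccI m → m = n) → F.FreeFor θ := by
  have keepG : ∀ {θ : Subst S} (z b : ℕ), (∀ x y, (θ.g x).OccG y → y = x ∨ b ≤ y) →
      (∀ x n, ¬ (θ.g x).OccI n) → (∀ x y, ((θ.keepG z).g x).OccG y → y = x ∨ b ≤ y) ∧
      ∀ x n, ¬ ((θ.keepG z).g x).OccI n := by
    intro θ z b h₁ h₂
    constructor <;> intro x <;> by_cases h : x = z
    · subst h; simp +contextual [Subst.keepG, GTerm.OccG]
    · simpa [Subst.keepG, h] using h₁ x
    · subst h; simp [Subst.keepG, GTerm.OccI]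
    · simpa [Subst.keepG, h] using h₂ x
  have keepI : ∀ {θ : Subst S} (z : ℕ), (∀ n m, (θ.i n).OccI m → m = n) →
      ∀ n m, ((θ.keepI z).i n).OccI m → m = n := by
    intro θ z h n
    by_cases e : n = z
    · subst e; simp [Subst.keepI, ITerm.OccI]
    · simpa [Subst.keepI, e] using h n
  induction F with
  | bot | pred | cmp => intros; trivial
  | and F G ihF ihG | or F G ihF ihG | imp F G ihF ihG =>
      intro θ h₁ h₂ h₃
      exact ⟨ihF (fun x y h => (h₁ x y h).imp_right (le_max_left _ _).trans) h₂ h₃,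
        ihG (fun x y h => (h₁ x y h).imp_right (le_max_right _ _).trans) h₂ h₃⟩
  | allG z F ih | exG z F ih =>
      intro θ h₁ h₂ h₃
      have h₁' := keepG z _ h₁ h₂
      refine ⟨fun y hy _ ho => ?_,
        ih (fun x y h => (h₁'.1 x y h).imp_right (le_max_right _ _).trans) h₁'.2 h₃⟩
      rcases h₁ y z ho with h | h
      · exact hy h.symm
      · exact absurd ((le_max_left _ _).trans h) (Nat.not_succ_le_self z)
  | allI z F ih | exI z F ih =>
      intro θ h₁ h₂ h₃
      exact ⟨⟨fun y _ => h₂ y z, fun y hy _ ho => hy (h₃ y z ho).symm⟩, ih h₁ h₂ (keepI z h₃)⟩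

omit [PrecomputedOrder S] in
theorem freeFor_singleI {F : Formula S σ} {n : ℕ} {t : ITerm} (ht : ∀ m, t.OccI m → m = n) :
    F.FreeFor (.singleI n t) := by
  refine freeFor_of_fresh (fun x y h => .inl (Eq.symm h)) (fun _ _ h => h) fun k m h => ?_
  by_cases e : k = n
  · subst e; exact ht m (by simpa [Subst.singleI] using h)
  · simpa [Subst.singleI, e, ITerm.OccI, eq_comm] using h

theorem force_iff {F G : Formula S σ} {H T : Interp S σ} {g : ℕ → PTerm S} {ρ : ℕ → ℤ} :
    (Formula.iff F G).Force H T g ρ ↔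
      (F.Force H T g ρ ↔ G.Force H T g ρ) ∧ (F.Force T T g ρ ↔ G.Force T T g ρ) := by
  simp only [Formula.iff, Force]; tauto

theorem Arithmetical.force_iff_holds {F : Formula S σ} (hF : F.Arithmetical) :
    ∀ {H T : Interp S σ} {g : ℕ → PTerm S} {ρ : ℕ → ℤ}, F.Force H T g ρ ↔ F.Holds g ρ := by
  induction F with
  | bot | cmp => intros; rfl
  | pred => exact hF.elim
  | and F G ihF ihG => intros; exact and_congr (ihF hF.1) (ihG hF.2)
  | or F G ihF ihG => intros; exact or_congr (ihF hF.1) (ihG hF.2)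
  | imp F G ihF ihG => intros; simp only [Force, Holds, ihF hF.1, ihG hF.2, and_self]
  | allG x F ih | allI x F ih => intros; exact forall_congr' fun _ => ih hF
  | exG x F ih | exI x F ih => intros; exact exists_congr fun _ => ih hF

end Formula

/-! ### Soundness -/

section Soundness

variable {S : Type} [PrecomputedOrder S] {σ : Signature}

/-- The semantic form of the schema `∃X(F → ∀X F)`, with `h` and `t` for the extents of `F` in the
two parts of an interpretation. Constant domains make it valid: a counterexample to `t` is taken as
the witness, or else a counterexample to `h`. -/
theorem exists_force_imp_forall {α : Type} [Nonempty α] {h t : α → Prop} (hht : ∀ a, h a → t a) :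
    ∃ a, (h a → ∀ b, h b) ∧ (t a → ∀ b, t b) := by
  by_cases ht : ∀ b, t b
  · by_cases hh : ∀ b, h b
    · exact ⟨Classical.arbitrary α, fun _ => hh, fun _ => ht⟩
    · obtain ⟨a, ha⟩ := not_forall.1 hh
      exact ⟨a, fun h => absurd h ha, fun _ => ht⟩
  · obtain ⟨a, ha⟩ := not_forall.1 ht
    exact ⟨a, fun h => absurd (hht a h) ha, fun h => absurd h ha⟩

theorem HTASchema.force {F : Formula S σ} (hF : HTASchema F) {H T : Interp S σ}
    (hHT : ∀ q a, H q a → T q a) (g : ℕ → PTerm S) (ρ : ℕ → ℤ) : F.Force H T g ρ := by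
  cases hF with
  | hosoi F G =>
      have hF := Formula.Force.mono hHT (F := F) (g := g) (ρ := ρ)
      have hG := Formula.Force.mono hHT (F := G) (g := g) (ρ := ρ)
      simp only [Formula.Force, Formula.neg]
      tauto
  | sqhtG x F =>
      have : Nonempty (PTerm S) := ⟨.inf⟩
      simp only [Formula.Force, Function.update_idem]
      exact exists_force_imp_forall fun r => Formula.Force.mono hHT
  | sqhtI n F =>
      simp only [Formula.Force, Function.update_idem]
      exact exists_force_imp_forall fun r => Formula.Force.mono hHT
  | std F hF h => exact hF.force_iff_holds.2 (h g ρ)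
  | induction n F =>
      -- the terms `0` and `n + 1` contain no variables other than `n`, so nothing is captured
      have h₀ : F.FreeFor (.singleI n (.num 0)) := Formula.freeFor_singleI fun m h => h.elim
      have h₁ : F.FreeFor (.singleI n (.add (.var n) (.num 1))) :=
        Formula.freeFor_singleI fun m h => h.elim Eq.symm False.elim
      simp only [Formula.Force, Formula.force_singleI h₀, Formula.force_singleI h₁,
        Function.update_idem, ITerm.eval, GTerm.eval, CmpSym.Holds, Function.update_self, ge_iff_le,
        PrecomputedOrder.num_le_num]
      have key : ∀ P : ℤ → Prop, P 0 → (∀ m, 0 ≤ m ∧ P m → P (m + 1)) → ∀ m, 0 ≤ m → P m :=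
        fun P h0 hs m hm => Int.leInduction h0 (fun k hk hP => hs k ⟨hk, hP⟩) m hm
      exact ⟨fun h m =>
          ⟨key _ h.1 (fun m => (h.2 m).1) m, key _ (h.1.mono hHT) (fun m => (h.2 m).2) m⟩,
        fun h m => ⟨key _ h.1 (fun m => (h.2 m).1) m, key _ h.1 (fun m => (h.2 m).2) m⟩⟩

/-- Soundness of the logic of here-and-there with arithmetic for here-and-there interpretations
over the standard domains. -/
theorem HTA.force {Ax : Set (Formula S σ)} {Γ : List (Formula S σ)} {F : Formula S σ}
    (hF : HTA Ax Γ F) {H T : Interp S σ} (hHT : ∀ q a, H q a → T q a)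
    (hAx : ∀ A ∈ Ax, ∀ g ρ, A.Force H T g ρ) (g : ℕ → PTerm S) (ρ : ℕ → ℤ)
    (hΓ : ∀ G ∈ Γ, G.Force H T g ρ) : F.Force H T g ρ := by
  have updG : ∀ {Γ : List (Formula S σ)} {H : Interp S σ} {g : ℕ → PTerm S} {ρ : ℕ → ℤ} {x : ℕ} r,
      (∀ G ∈ Γ, ¬ G.FreeG x) → (∀ G ∈ Γ, G.Force H T g ρ) →
      ∀ G ∈ Γ, G.Force H T (Function.update g x r) ρ := by
    intro Γ H g ρ x r hx hΓ G hG
    refine (Formula.force_congr (fun y hy => ?_) fun _ _ => rfl).1 (hΓ G hG)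
    have : y ≠ x := fun e => hx G hG (e ▸ hy)
    simp [this]
  have updI : ∀ {Γ : List (Formula S σ)} {H : Interp S σ} {g : ℕ → PTerm S} {ρ : ℕ → ℤ} {n : ℕ} m,
      (∀ G ∈ Γ, ¬ G.FreeI n) → (∀ G ∈ Γ, G.Force H T g ρ) →
      ∀ G ∈ Γ, G.Force H T g (Function.update ρ n m) := by
    intro Γ H g ρ x r hx hΓ G hG
    refine (Formula.force_congr (fun _ _ => rfl) fun y hy => ?_).1 (hΓ G hG)
    have : y ≠ x := fun e => hx G hG (e ▸ hy)
    simp [this]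
  have restG : ∀ {G : Formula S σ} {H : Interp S σ} {g : ℕ → PTerm S} {ρ : ℕ → ℤ} {x : ℕ} r,
      ¬ G.FreeG x → G.Force H T (Function.update g x r) ρ → G.Force H T g ρ := by
    intro G H g ρ x r hx hG
    refine (Formula.force_congr (fun y hy => ?_) fun _ _ => rfl).1 hG
    have : y ≠ x := fun e => hx (e ▸ hy)
    simp [this]
  have restI : ∀ {G : Formula S σ} {H : Interp S σ} {g : ℕ → PTerm S} {ρ : ℕ → ℤ} {n : ℕ} m,
      ¬ G.FreeI n → G.Force H T g (Function.update ρ n m) → G.Force H T g ρ := by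
    intro G H g ρ x r hx hG
    refine (Formula.force_congr (fun _ _ => rfl) fun y hy => ?_).1 hG
    have : y ≠ x := fun e => hx (e ▸ hy)
    simp [this]
  induction hF generalizing H g ρ with
  | hyp h => exact hΓ _ h
  | ax h => exact hAx _ h g ρ
  | schema h => exact h.force hHT g ρ
  | weaken hs _ ih => exact ih hHT hAx g ρ fun G hG => hΓ G (hs hG)
  | botE _ ih => exact (ih hHT hAx g ρ hΓ).elim
  | andI _ _ ih₁ ih₂ => exact ⟨ih₁ hHT hAx g ρ hΓ, ih₂ hHT hAx g ρ hΓ⟩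
  | andE₁ _ ih => exact (ih hHT hAx g ρ hΓ).1
  | andE₂ _ ih => exact (ih hHT hAx g ρ hΓ).2
  | orI₁ _ ih => exact .inl (ih hHT hAx g ρ hΓ)
  | orI₂ _ ih => exact .inr (ih hHT hAx g ρ hΓ)
  | orE _ _ _ ih ih₁ ih₂ =>
      rcases ih hHT hAx g ρ hΓ with h | h
      · exact ih₁ hHT hAx g ρ (List.forall_mem_cons.2 ⟨h, hΓ⟩)
      · exact ih₂ hHT hAx g ρ (List.forall_mem_cons.2 ⟨h, hΓ⟩)
  | impI _ ih =>
      refine ⟨fun h => ih hHT hAx g ρ (List.forall_mem_cons.2 ⟨h, hΓ⟩), fun h => ?_⟩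
      -- the second conjunct is the induction hypothesis for the total interpretation `⟨T, T⟩`
      exact ih (fun _ _ => id) (fun A hA g ρ => (hAx A hA g ρ).mono hHT) g ρ
        (List.forall_mem_cons.2 ⟨h, fun G hG => (hΓ G hG).mono hHT⟩)
  | impE _ _ ih₁ ih₂ => exact (ih₂ hHT hAx g ρ hΓ).1 (ih₁ hHT hAx g ρ hΓ)
  | allGI hx _ ih => exact fun r => ih hHT hAx _ ρ (updG r hx hΓ)
  | allGE t ht _ ih => exact (Formula.force_singleG ht).2 (ih hHT hAx g ρ hΓ _)
  | exGI t ht _ ih => exact ⟨_, (Formula.force_singleG ht).1 (ih hHT hAx g ρ hΓ)⟩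
  | exGE hx hG _ _ ih₁ ih₂ =>
      obtain ⟨r, hr⟩ := ih₁ hHT hAx g ρ hΓ
      exact restG r hG (ih₂ hHT hAx _ ρ (List.forall_mem_cons.2 ⟨hr, updG r hx hΓ⟩))
  | allII hx _ ih => exact fun m => ih hHT hAx g _ (updI m hx hΓ)
  | allIE t ht _ ih => exact (Formula.force_singleI ht).2 (ih hHT hAx g ρ hΓ _)
  | exII t ht _ ih => exact ⟨_, (Formula.force_singleI ht).1 (ih hHT hAx g ρ hΓ)⟩
  | exIE hx hG _ _ ih₁ ih₂ =>
      obtain ⟨m, hm⟩ := ih₁ hHT hAx g ρ hΓ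
      exact restI m hG (ih₂ hHT hAx g _ (List.forall_mem_cons.2 ⟨hm, updI m hx hΓ⟩))
  | eqRefl t => exact rfl
  | eqSubstG t₁ t₂ h₁ h₂ _ _ ih₁ ih₂ =>
      have e : t₁.eval g ρ = t₂.eval g ρ := ih₁ hHT hAx g ρ hΓ
      exact (Formula.force_singleG h₂).2 (e ▸ (Formula.force_singleG h₁).1 (ih₂ hHT hAx g ρ hΓ))
  | eqSubstI t₁ t₂ h₁ h₂ _ _ ih₁ ih₂ =>
      have e : t₁.eval ρ = t₂.eval ρ := PTerm.num.inj (ih₁ hHT hAx g ρ hΓ)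
      exact (Formula.force_singleI h₂).2 (e ▸ (Formula.force_singleI h₁).1 (ih₂ hHT hAx g ρ hΓ))

end Soundness

/-! ### Here-and-there semantics of infinitary propositional formulas -/

namespace InfFormula

variable {A : Type}

/-- Satisfaction of an infinitary formula in the here-and-there interpretation with the "here" part
`J` and the "there" part `I`. -/
def HT : InfFormula A → Set A → Set A → Prop
  | atom a, J, _ => a ∈ J
  | conj _ f, J, I => ∀ i, (f i).HT J I
  | disj _ f, J, I => ∃ i, (f i).HT J I
  | imp F G, J, I => (F.HT J I → G.HT J I) ∧ (F.HT I I → G.HT I I)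

theorem HT.mono {J I : Set A} (hJI : J ⊆ I) : ∀ {F : InfFormula A}, F.HT J I → F.HT I I
  | atom _, h => hJI h
  | conj _ _, h => fun i => (h i).mono hJI
  | disj _ _, ⟨i, h⟩ => ⟨i, h.mono hJI⟩
  | imp _ _, h => ⟨h.2, h.2⟩

theorem ht_self_iff_sat {I : Set A} {F : InfFormula A} : F.HT I I ↔ F.Sat I := by
  induction F with
  | atom a => rfl
  | conj ι f ih => exact forall_congr' ih
  | disj ι f ih => exact exists_congr ih
  | imp F G ihF ihG => simp only [HT, Sat, ihF, ihG, and_self]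

/-- The reduct relative to `I` expresses satisfaction in here-and-there interpretations whose there
part is `I`. -/
theorem sat_reduct_iff_ht {J I : Set A} (hJI : J ⊆ I) {F : InfFormula A} :
    (F.reduct I).Sat J ↔ F.HT J I := by
  induction F with
  | atom a =>
      by_cases ha : a ∈ I
      · simp [reduct, ha, Sat, HT]
      · simpa [reduct, ha, Sat, HT, bot] using fun h => ha (hJI h)
  | conj ι f ih => exact forall_congr' ih
  | disj ι f ih => exact exists_congr ih
  | imp F G ihF ihG =>
      simp only [HT, ht_self_iff_sat]
      by_cases h : F.Sat I → G.Sat I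
      · have h' : (imp F G).Sat I := h
        rw [reduct, if_pos h']
        exact (imp_congr ihF ihG).trans (and_iff_left h).symm
      · simp [reduct, Sat, bot, h]

/-- Formulas with the same here-and-there models are strongly equivalent. -/
theorem stronglyEquivalent_of_ht {F G : InfFormula A}
    (h : ∀ J I : Set A, J ⊆ I → (F.HT J I ↔ G.HT J I)) : StronglyEquivalent F G := by
  intro H I
  have key : ∀ J ⊆ I, (∀ K ∈ ({F} ∪ H : Set _), (K.reduct I).Sat J) ↔
      ∀ K ∈ ({G} ∪ H : Set _), (K.reduct I).Sat J := by
    intro J hJ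
    simp only [Set.singleton_union, Set.forall_mem_insert, sat_reduct_iff_ht hJ, h J I hJ]
  constructor
  · exact fun hI => ⟨(key I subset_rfl).1 hI.1, fun J hJ hle => hI.2 ((key J hle).2 hJ) hle⟩
  · exact fun hI => ⟨(key I subset_rfl).2 hI.1, fun J hJ hle => hI.2 ((key J hle).1 hJ) hle⟩

variable {J I : Set A}

theorem not_ht_bot : ¬ (bot : InfFormula A).HT J I := fun ⟨i, _⟩ => i.elim

theorem ht_top : (top : InfFormula A).HT J I := fun i => i.elim

theorem ht_ite {P : Prop} {_ : Decidable P} : (if P then top else bot : InfFormula A).HT J I ↔ P := by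
  split
  · next h => exact iff_of_true ht_top h
  · next h => exact iff_of_false not_ht_bot h

/-- A negation holds if and only if it holds in the there part. -/
theorem ht_neg (hJI : J ⊆ I) {F : InfFormula A} : F.neg.HT J I ↔ ¬ F.HT I I := by
  simp only [neg, HT, not_ht_bot]
  exact ⟨fun h => h.2, fun h => ⟨fun h' => h (h'.mono hJI), h⟩⟩

theorem ht_or {F G : InfFormula A} : (or F G).HT J I ↔ F.HT J I ∨ G.HT J I := by
  simp [or, HT, or_comm]

theorem ht_listConj {l : List (InfFormula A)} : (listConj l).HT J I ↔ ∀ F ∈ l, F.HT J I := by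
  simp only [listConj, HT, List.forall_mem_iff_get]

end InfFormula

/-! ### Strings of quantifiers and lists of formulas -/

/-- The assignment that agrees with `e` on the members of `l`, and with `g` elsewhere. -/
def override {α : Type} (l : List ℕ) (e g : ℕ → α) : ℕ → α :=
  fun x => if x ∈ l then e x else g x

@[simp] theorem override_nil {α : Type} (e g : ℕ → α) : override [] e g = g := by
  funext x; simp [override]

theorem override_cons {α : Type} (y : ℕ) (l : List ℕ) (e g : ℕ → α) :
    override (y :: l) e g = override l e (Function.update g y (e y)) := by
  funext x
  by_cases h : x ∈ l <;> by_cases h' : x = y <;> simp [override, h, h']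

theorem override_override_const {α : Type} (y : ℕ) (l : List ℕ) (e g : ℕ → α) (r : α) :
    override l (override l e fun _ => r)
      (Function.update g y (override l e (fun _ => r) y)) =
      override l e (Function.update g y r) := by
  funext x
  by_cases h : x ∈ l <;> by_cases h' : x = y <;> simp [override, h, h']

theorem override_of_mem {α : Type} {l : List ℕ} {e g : ℕ → α} {x : ℕ} (h : x ∈ l) :
    override l e g x = e x := if_pos h

theorem override_of_notMem {α : Type} {l : List ℕ} {e g : ℕ → α} {x : ℕ} (h : x ∉ l) :
    override l e g x = g x := if_neg h

theorem lt_above {l : List ℕ} {x : ℕ} (h : x ∈ l) : x < above l := by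
  induction l with
  | nil => simp at h
  | cons y l ih =>
      rcases List.mem_cons.1 h with h | h
      · subst h; exact lt_of_lt_of_le (Nat.lt_succ_self _) (le_max_left _ _)
      · exact lt_of_lt_of_le (ih h) (le_max_right _ _)

theorem mem_freshList {b n x : ℕ} : x ∈ freshList b n ↔ b ≤ x ∧ x < b + n := by
  simp only [freshList, List.mem_map, List.mem_range]
  exact ⟨fun ⟨i, hi, h⟩ => by omega, fun h => ⟨x - b, by omega, by omega⟩⟩

theorem notMem_freshList_above {l : List ℕ} {x n : ℕ} (h : x ∈ l) :
    x ∉ freshList (above l) n := by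
  have := lt_above h
  rw [mem_freshList]; omega

section Force

variable {S : Type} [PrecomputedOrder S] {σ : Signature} {H T : Interp S σ} {ρ : ℕ → ℤ}

theorem Formula.force_exsG {F : Formula S σ} : ∀ {l : List ℕ} {g : ℕ → PTerm S},
    (Formula.exsG l F).Force H T g ρ ↔ ∃ e, F.Force H T (override l e g) ρ
  | [], g => by simpa [exsG] using fun _ => ⟨PTerm.inf⟩
  | y :: l, g => by
      have h : (Formula.exsG (y :: l) F).Force H T g ρ ↔
          ∃ r e, F.Force H T (override l e (Function.update g y r)) ρ :=
        exists_congr fun r => Formula.force_exsG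
      rw [h]
      simp only [override_cons]
      refine ⟨fun ⟨r, e, he⟩ => ⟨override l e fun _ => r, ?_⟩, fun ⟨e, he⟩ => ⟨e y, e, he⟩⟩
      rwa [override_override_const]

theorem Formula.force_allsG {F : Formula S σ} : ∀ {l : List ℕ} {g : ℕ → PTerm S},
    (Formula.allsG l F).Force H T g ρ ↔ ∀ e, F.Force H T (override l e g) ρ
  | [], g => ⟨fun h e => h, fun h => h fun _ => .inf⟩
  | y :: l, g => by
      have h : (Formula.allsG (y :: l) F).Force H T g ρ ↔
          ∀ r e, F.Force H T (override l e (Function.update g y r)) ρ :=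
        forall_congr' fun r => Formula.force_allsG
      rw [h]
      simp only [override_cons]
      refine ⟨fun he e => he (e y) e, fun he r e => ?_⟩
      simpa only [override_override_const] using he (override l e fun _ => r)

theorem Formula.force_top {g : ℕ → PTerm S} : (Formula.top : Formula S σ).Force H T g ρ :=
  ⟨id, id⟩

theorem Formula.force_bigAnd {g : ℕ → PTerm S} : ∀ {l : List (Formula S σ)},
    (Formula.bigAnd l).Force H T g ρ ↔ ∀ F ∈ l, F.Force H T g ρ
  | [] => by simp [bigAnd, force_top]
  | [F] => by simp [bigAnd]
  | F :: G :: l => by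
      rw [List.forall_mem_cons, ← Formula.force_bigAnd]; rfl

theorem Formula.force_bigOr {g : ℕ → PTerm S} : ∀ {l : List (Formula S σ)},
    (Formula.bigOr l).Force H T g ρ ↔ ∃ F ∈ l, F.Force H T g ρ
  | [] => by simp [bigOr, Force]
  | [F] => by simp [bigOr]
  | F :: G :: l => by
      rw [List.exists_mem_cons_iff, ← Formula.force_bigOr]; rfl

end Force

/-! ### The predicates representing aggregates -/

/-- At least, respectively at most, `c` elements satisfy a condition; `A` and `B` are the extents of
the condition in the "here" and in the "there" part of an interpretation. An upper bound on the
number of elements is a negative condition, so that it depends on `B` only. -/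
def CountRel.Holds {S : Type} [PrecomputedOrder S] {α : Type} :
    CountRel → PTerm S → (α → Prop) → (α → Prop) → Prop
  | .atLeast, c, A, _ => ∃ Δ : Finset α, .num (Δ.card : ℤ) ≥ c ∧ ∀ x ∈ Δ, A x
  | .atMost, c, _, B => ∀ Δ : Finset α, .num (Δ.card : ℤ) > c → ¬ ∀ x ∈ Δ, B x

/-- The assignment that maps the members of `X` to the members of the tuple `x`, and agrees with `g`
elsewhere. -/
def tupleAssign {S : Type} (X : List ℕ) (x : Fin X.length → PTerm S) (g : ℕ → PTerm S) :
    ℕ → PTerm S :=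
  fun v => (tupleSubst X x v).getD (g v)

/-- The atoms `p(r₁, …, rₙ)` of `J` as the extents of the predicate constants of `σ₀`. -/
def interp₀ {S : Type} (J : Set (PAtom S)) : Interp S (sigma0 S) :=
  fun q a => (⟨q.1, List.ofFn a⟩ : PAtom S) ∈ J

/-- The part, corresponding to `J`, of the here-and-there interpretation of `σ₁` determined by
`J` and `I`: `Atleast` and `Atmost` are true of a tuple if the number of values of `X` satisfying
the subscript `F` is bounded as required. The "there" part is the case `J = I`. -/
def interp₁ {S : Type} [PrecomputedOrder S] (J I : Set (PAtom S)) : Interp S (sigma1 S)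
  | .inl q => interp₀ J q
  | .inr q => fun a =>
      let g := tupleAssign q.V (fun i => a i.castSucc) fun _ => .inf
      q.rel.Holds (a (Fin.last _))
        (fun x => q.F.Force (interp₀ J) (interp₀ I) (tupleAssign q.X x g) 0)
        (fun x => q.F.Force (interp₀ I) (interp₀ I) (tupleAssign q.X x g) 0)

section Interp

variable {S : Type}

theorem tupleAssign_of_notMem {X : List ℕ} {x : Fin X.length → PTerm S} {g : ℕ → PTerm S} {v : ℕ}
    (h : v ∉ X) : tupleAssign X x g v = g v := by
  have : ¬ X.idxOf v < X.length := fun h' => h (List.idxOf_lt_length_iff.1 h')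
  simp [tupleAssign, tupleSubst, this]

theorem tupleSubst_of_mem {X : List ℕ} {x : Fin X.length → PTerm S} (g : ℕ → PTerm S) {v : ℕ}
    (h : v ∈ X) : tupleSubst X x v = some (tupleAssign X x g v) := by
  have : X.idxOf v < X.length := List.idxOf_lt_length_iff.2 h
  simp [tupleAssign, tupleSubst, this]

theorem tupleSubst_of_notMem {X : List ℕ} {x : Fin X.length → PTerm S} {v : ℕ}
    (h : v ∉ X) : tupleSubst X x v = none := by
  have : ¬ X.idxOf v < X.length := fun h' => h (List.idxOf_lt_length_iff.1 h')
  simp [tupleSubst, this]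

theorem tupleAssign_of_mem {X : List ℕ} {x : Fin X.length → PTerm S} {g : ℕ → PTerm S} {v : ℕ}
    (h : v ∈ X) : tupleAssign X x g v = x ⟨X.idxOf v, List.idxOf_lt_length_iff.2 h⟩ := by
  have : X.idxOf v < X.length := List.idxOf_lt_length_iff.2 h
  simp [tupleAssign, tupleSubst, this]

/-- Overriding an assignment on the members of a list is the same as assigning a tuple to the
list. -/
theorem exists_override_iff {X : List ℕ} {g : ℕ → PTerm S}
    {P : (ℕ → PTerm S) → Prop} :
    (∃ e, P (override X e g)) ↔ ∃ x : Fin X.length → PTerm S, P (tupleAssign X x g) := by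
  constructor
  · rintro ⟨e, he⟩
    refine ⟨fun i => e X[i], ?_⟩
    convert he using 1
    funext v
    by_cases h : v ∈ X
    · simp [tupleAssign_of_mem h, override, h]
    · rw [tupleAssign_of_notMem h, override_of_notMem h]
  · rintro ⟨x, hx⟩
    refine ⟨tupleAssign X x g, ?_⟩
    convert hx using 1
    funext v
    by_cases h : v ∈ X
    · rw [override_of_mem h]
    · rw [tupleAssign_of_notMem h, override_of_notMem h]

variable {J I : Set (PAtom S)}

theorem interp₀_mono (hJI : J ⊆ I) (q a) : interp₀ J q a → interp₀ I q a := fun h => hJI h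

variable [PrecomputedOrder S]

theorem CountRel.Holds.mono {α : Type} {A A' B : α → Prop} (hA : ∀ x, A x → A' x) {c : PTerm S} :
    ∀ {rel : CountRel}, rel.Holds c A B → rel.Holds c A' B
  | .atLeast, ⟨Δ, h, h'⟩ => ⟨Δ, h, fun x hx => hA x (h' x hx)⟩
  | .atMost, h => h

theorem interp₁_mono (hJI : J ⊆ I) : ∀ q a, interp₁ J I q a → interp₁ I I q a
  | .inl _, _, h => hJI h
  | .inr _, _, h =>
      CountRel.Holds.mono (fun _ => Formula.Force.mono (interp₀_mono hJI)) h

theorem Formula.force_toSigma1 {F : Formula S (sigma0 S)} : ∀ {J I : Set (PAtom S)} {g ρ},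
    F.toSigma1.Force (interp₁ J I) (interp₁ I I) g ρ ↔ F.Force (interp₀ J) (interp₀ I) g ρ := by
  induction F with
  | bot | pred | cmp => intros; rfl
  | and F G ihF ihG => intros; exact and_congr ihF ihG
  | or F G ihF ihG => intros; exact or_congr ihF ihG
  | imp F G ihF ihG => intros; exact and_congr (imp_congr ihF ihG) (imp_congr ihF ihG)
  | allG x F ih | allI x F ih => intros; exact forall_congr' fun _ => ih
  | exG x F ih | exI x F ih => intros; exact exists_congr fun _ => ih

/-- The values that `interp₁` gives to variables outside `V` and to integer variables are irrelevant,
since all free variables of the subscript belong to `X` or `V`. -/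
theorem CountPred.force_app {q : CountPred S} {c : GTerm S} {g : ℕ → PTerm S} {ρ : ℕ → ℤ}
    {T : Interp S (sigma1 S)} :
    (q.app c).Force (interp₁ J I) T g ρ ↔
      q.rel.Holds (c.eval g ρ)
        (fun x => q.F.Force (interp₀ J) (interp₀ I) (tupleAssign q.X x g) ρ)
        (fun x => q.F.Force (interp₀ I) (interp₀ I) (tupleAssign q.X x g) ρ) := by
  have key : ∀ (K : Set (PAtom S)) (x : Fin q.X.length → PTerm S) (t : Fin q.V.length → PTerm S),
      (∀ i, t i = g (q.V.get i)) →
      q.F.Force (interp₀ K) (interp₀ I) (tupleAssign q.X x (tupleAssign q.V t fun _ => .inf)) 0 =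
      q.F.Force (interp₀ K) (interp₀ I) (tupleAssign q.X x g) ρ := by
    intro K x t ht
    refine propext (Formula.force_congr (fun v hv => ?_) fun n hn => (q.freeI n hn).elim)
    by_cases hX : v ∈ q.X
    · rw [tupleAssign_of_mem hX, tupleAssign_of_mem hX]
    · have hV := (q.freeG v hv).resolve_left hX
      rw [tupleAssign_of_notMem hX, tupleAssign_of_notMem hX, tupleAssign_of_mem hV, ht]
      simp
  simp only [CountPred.app, Formula.Force, interp₁]
  have e : ∀ i : Fin q.V.length, GTerm.eval g ρ (Fin.snoc (α := fun _ => GTerm S)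
      (fun i : Fin q.V.length => GTerm.var (q.V.get i)) c i.castSucc) = g (q.V.get i) := fun i => by
    simp [GTerm.eval]
  simp only [key _ _ _ e]
  simp

end Interp

/-! ### The sentences defining the predicates are satisfied -/

section Counting

theorem mem_pairs {n i j : ℕ} : (i, j) ∈ pairs n ↔ i < j ∧ j < n := by
  simp [pairs, and_comm]

/-- A sequence of tuples of length `m` as values of consecutive variables. -/
theorem exists_eq_block {α : Type} [Inhabited α] (b m : ℕ) (s : ℕ → Fin m → α) :
    ∃ e : ℕ → α, ∀ i (k : Fin m), e (b + i * m + k) = s i k := by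
  -- the variable `z` is number `(z - b) % m` in block number `(z - b) / m`
  refine ⟨fun z => if h : (z - b) % m < m then s ((z - b) / m) ⟨_, h⟩ else default, fun i k => ?_⟩
  have h₁ : b + i * m + k - b = k + m * i := by rw [Nat.mul_comm m i]; omega
  have h₂ : (k + m * i) % m = k := by rw [Nat.add_mul_mod_self_left, Nat.mod_eq_of_lt k.2]
  have h₃ : (k + m * i) / m = i := by
    rw [Nat.add_mul_div_left _ _ (Nat.zero_lt_of_lt k.2), Nat.div_eq_of_lt k.2, Nat.zero_add]
  simp only [h₁, h₂, h₃, k.2, dite_true]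

theorem exists_finset_iff_exists_seq {α : Type} [Inhabited α] {A : α → Prop} {n : ℕ} :
    (∃ Δ : Finset α, n ≤ Δ.card ∧ ∀ x ∈ Δ, A x) ↔
      ∃ s : ℕ → α, (∀ i < n, A (s i)) ∧ ∀ i j, i < j → j < n → s i ≠ s j := by
  classical
  constructor
  · rintro ⟨Δ, hn, hA⟩
    have hlen : Δ.toList.length = Δ.card := Δ.length_toList
    refine ⟨fun i => Δ.toList.getD i default, fun i hi => ?_, fun i j hij hj => ?_⟩ <;> beta_reduce
    · have hi' : i < Δ.toList.length := by omega
      rw [List.getD_eq_getElem _ _ hi']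
      exact hA _ (Finset.mem_toList.1 (List.getElem_mem _))
    · rw [List.getD_eq_getElem _ _ (by omega), List.getD_eq_getElem _ _ (by omega)]
      exact fun h => hij.ne ((Δ.nodup_toList.getElem_inj_iff).1 h)
  · rintro ⟨s, hA, hs⟩
    refine ⟨(Finset.range n).image s, ?_, ?_⟩
    · rw [Finset.card_image_of_injOn, Finset.card_range]
      intro i hi j hj h
      simp only [Finset.coe_range, Set.mem_Iio] at hi hj
      rcases lt_trichotomy i j with h' | h' | h'
      · exact absurd h (hs i j h' hj)
      · exact h'
      · exact absurd h.symm (hs j i h' hi)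
    · simpa using hA

variable {S : Type} [PrecomputedOrder S] {H T : Interp S (sigma0 S)} {ρ : ℕ → ℤ}

theorem force_copyF {X : List ℕ} {F : Formula S (sigma0 S)} {b : ℕ} (hb : F.freshG ≤ b)
    {i : ℕ} {g : ℕ → PTerm S} :
    (copyF X F b i).Force H T g ρ ↔
      F.Force H T (tupleAssign X (fun k => g (b + i * X.length + k)) g) ρ := by
  rw [copyF, Formula.force_subst]
  · refine Formula.force_congr (fun v _ => ?_) fun _ _ => rfl
    by_cases h : X.idxOf v < X.length <;> simp [tupleAssign, tupleSubst, h, GTerm.eval]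
  · refine Formula.freeFor_of_fresh (fun x y h => ?_) (fun x n h => ?_) fun _ _ h => Eq.symm h
    · by_cases hx : X.idxOf x < X.length
      · simp only [hx, if_true, GTerm.OccG] at h
        exact .inr (by omega)
      · simp only [hx, if_false, GTerm.OccG] at h
        exact .inl h.symm
    · by_cases hx : X.idxOf x < X.length <;> simp [hx, GTerm.OccI] at h

theorem force_tupleEq {X : List ℕ} {b i j : ℕ} {g : ℕ → PTerm S} :
    (tupleEq X b i j).Force H T g ρ ↔ (fun k : Fin X.length => g (b + i * X.length + k)) =
      fun k : Fin X.length => g (b + j * X.length + k) := by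
  simp only [tupleEq, Formula.force_bigAnd, List.forall_mem_map, List.mem_range, Formula.Force,
    GTerm.eval, CmpSym.Holds, funext_iff, Fin.forall_iff]

theorem block_mem_freshList {b n i m : ℕ} (hi : i < n) (k : Fin m) :
    b + i * m + k ∈ freshList b (n * m) := by
  have : (i + 1) * m ≤ n * m := Nat.mul_le_mul_right m hi
  have := k.2
  rw [Nat.add_one_mul] at *
  rw [mem_freshList]; omega

/-- The fresh variables occur neither among `V` nor in `F`, so that overriding their values affects
a copy of `F` only through the tuple substituted for `X`. -/
theorem force_copyF_override {X V : List ℕ} {F : Formula S (sigma0 S)} {b n i : ℕ}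
    (hF : ∀ x, F.FreeG x → x ∈ X ∨ x ∈ V) (hb : F.freshG ≤ b) (hV : ∀ v ∈ V, v < b) (hi : i < n)
    {e g : ℕ → PTerm S} :
    (copyF X F b i).Force H T (override (freshList b (n * X.length)) e g) ρ ↔
      F.Force H T (tupleAssign X (fun k => e (b + i * X.length + k)) g) ρ := by
  rw [force_copyF hb]
  refine Formula.force_congr (fun v hv => ?_) fun _ _ => rfl
  by_cases hX : v ∈ X
  · rw [tupleAssign_of_mem hX, tupleAssign_of_mem hX, override_of_mem (block_mem_freshList hi _)]
  · rw [tupleAssign_of_notMem hX, tupleAssign_of_notMem hX, override_of_notMem]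
    have := hV v ((hF v hv).resolve_left hX)
    rw [mem_freshList]; omega

theorem force_tupleEq_override {X : List ℕ} {b n i j : ℕ} (hi : i < n) (hj : j < n)
    {e g : ℕ → PTerm S} :
    (tupleEq X b i j).Force H T (override (freshList b (n * X.length)) e g) ρ ↔
      (fun k : Fin X.length => e (b + i * X.length + k)) =
        fun k : Fin X.length => e (b + j * X.length + k) := by
  simp only [force_tupleEq, override_of_mem (block_mem_freshList hi _),
    override_of_mem (block_mem_freshList hj _)]

theorem force_atLeastF {X V : List ℕ} {F : Formula S (sigma0 S)} {b n : ℕ}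
    (hF : ∀ x, F.FreeG x → x ∈ X ∨ x ∈ V) (hb : F.freshG ≤ b) (hV : ∀ v ∈ V, v < b)
    {g : ℕ → PTerm S} :
    (atLeastF X F b n).Force H T g ρ ↔ ∃ Δ : Finset (Fin X.length → PTerm S),
      n ≤ Δ.card ∧ ∀ x ∈ Δ, F.Force H T (tupleAssign X x g) ρ := by
  have : Inhabited (PTerm S) := ⟨.inf⟩
  rw [exists_finset_iff_exists_seq, atLeastF, Formula.force_exsG]
  have h : ∀ e : ℕ → PTerm S, ((Formula.bigAnd ((List.range n).map (copyF X F b))).and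
      (.bigAnd ((pairs n).map fun ij => (tupleEq X b ij.1 ij.2).neg))).Force H T
        (override (freshList b (n * X.length)) e g) ρ ↔
      (∀ i < n, F.Force H T (tupleAssign X (fun k => e (b + i * X.length + k)) g) ρ) ∧
      ∀ i j, i < j → j < n → (fun k : Fin X.length => e (b + i * X.length + k)) ≠
        fun k : Fin X.length => e (b + j * X.length + k) := by
    intro e
    simp only [Formula.Force, Formula.force_bigAnd, List.forall_mem_map, List.mem_range, Prod.forall,
      mem_pairs, Formula.neg, and_imp]
    refine and_congr (forall₂_congr fun i hi => force_copyF_override hF hb hV hi)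
      (forall₄_congr fun i j hij hj => ?_)
    rw [force_tupleEq_override (hij.trans hj) hj, force_tupleEq_override (hij.trans hj) hj, and_self]
  simp only [h]
  constructor
  · rintro ⟨e, he⟩
    exact ⟨_, he⟩
  · rintro ⟨s, hs⟩
    obtain ⟨e, he⟩ := exists_eq_block b X.length s
    refine ⟨e, ?_⟩
    simpa only [he] using hs

theorem force_atMostF {X V : List ℕ} {F : Formula S (sigma0 S)} {b n : ℕ}
    (hHT : ∀ q a, H q a → T q a)
    (hF : ∀ x, F.FreeG x → x ∈ X ∨ x ∈ V) (hb : F.freshG ≤ b) (hV : ∀ v ∈ V, v < b)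
    {g : ℕ → PTerm S} :
    (atMostF X F b n).Force H T g ρ ↔ ∀ Δ : Finset (Fin X.length → PTerm S),
      n + 1 ≤ Δ.card → ¬ ∀ x ∈ Δ, F.Force T T (tupleAssign X x g) ρ := by
  have : Inhabited (PTerm S) := ⟨.inf⟩
  have hex := exists_finset_iff_exists_seq (n := n + 1)
    (A := fun x : Fin X.length → PTerm S => F.Force T T (tupleAssign X x g) ρ)
  have hneg : (∀ Δ : Finset (Fin X.length → PTerm S),
      n + 1 ≤ Δ.card → ¬ ∀ x ∈ Δ, F.Force T T (tupleAssign X x g) ρ) ↔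
      ¬ ∃ Δ : Finset (Fin X.length → PTerm S),
        n + 1 ≤ Δ.card ∧ ∀ x ∈ Δ, F.Force T T (tupleAssign X x g) ρ := by
    simp only [not_exists, not_and]
  rw [hneg, hex, atMostF, Formula.force_allsG]
  have h : ∀ (H : Interp S (sigma0 S)) (e : ℕ → PTerm S),
      (Formula.bigAnd ((List.range (n + 1)).map (copyF X F b))).Force H T
        (override (freshList b ((n + 1) * X.length)) e g) ρ ↔
      ∀ i < n + 1, F.Force H T (tupleAssign X (fun k => e (b + i * X.length + k)) g) ρ := by
    intro H e
    simp only [Formula.force_bigAnd, List.forall_mem_map, List.mem_range]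
    exact forall₂_congr fun i hi => force_copyF_override hF hb hV hi
  have h' : ∀ (H : Interp S (sigma0 S)) (e : ℕ → PTerm S),
      (Formula.bigOr ((pairs (n + 1)).map fun ij => tupleEq X b ij.1 ij.2)).Force H T
        (override (freshList b ((n + 1) * X.length)) e g) ρ ↔
      ∃ i j, (i < j ∧ j < n + 1) ∧ (fun k : Fin X.length => e (b + i * X.length + k)) =
        fun k : Fin X.length => e (b + j * X.length + k) := by
    intro H e
    simp only [Formula.force_bigOr, List.mem_map, Prod.exists, mem_pairs, ↓existsAndEq,
      and_true]
    exact exists₂_congr fun i j => and_congr_right fun hij =>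
      force_tupleEq_override (hij.1.trans hij.2) hij.2
  simp only [Formula.Force, h, h']
  constructor
  · rintro hf ⟨s, hs, hs'⟩
    obtain ⟨e, he⟩ := exists_eq_block b X.length s
    obtain ⟨i, j, hij, hne⟩ := (hf e).2 (by simpa only [he] using hs)
    exact hs' i j hij.1 hij.2 (by simpa only [he] using hne)
  · intro hf e
    -- equality means the same here and there, so the implication here follows from the one there
    have key : (∀ i < n + 1, F.Force T T (tupleAssign X (fun k => e (b + i * X.length + k)) g) ρ) →
        ∃ i j, (i < j ∧ j < n + 1) ∧ (fun k : Fin X.length => e (b + i * X.length + k)) =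
          fun k : Fin X.length => e (b + j * X.length + k) := by
      intro hA
      by_contra hne
      push Not at hne
      exact hf ⟨_, hA, fun i j hij hj => hne i j ⟨hij, hj⟩⟩
    exact ⟨fun hA => key fun i hi => (hA i hi).mono hHT, key⟩

theorem PTerm.num_lt_num {m n : ℤ} : (.num m : PTerm S) < .num n ↔ m < n := by
  rw [← not_le, ← not_le, PrecomputedOrder.num_le_num]

/-- By contiguity, a precomputed term that is not a numeral and is above some numeral is above all of
them. -/
theorem PTerm.num_lt_of_not_num {r : PTerm S} (hr : ∀ k : ℤ, r ≠ .num k) {m : ℤ} (h : .num m ≤ r)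
    (n : ℤ) : .num n < r := by
  by_contra h'
  obtain ⟨k, hk⟩ := PrecomputedOrder.contiguous m n r h (not_lt.1 h')
  exact hr k hk

/-- The expressions `∃_{≥ r} X F` and `∃_{≤ r} X F` have the intended meaning. -/
theorem CountPred.force_expansion (hHT : ∀ q a, H q a → T q a) {q : CountPred S} {r : PTerm S}
    {g : ℕ → PTerm S} :
    (q.expansion r).Force H T g ρ ↔
      q.rel.Holds r (fun x => q.F.Force H T (tupleAssign q.X x g) ρ)
        (fun x => q.F.Force T T (tupleAssign q.X x g) ρ) := by
  have hb : q.F.freshG ≤ max q.F.freshG (above (q.X ++ q.V)) := le_max_left _ _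
  have hV : ∀ v ∈ q.V, v < max q.F.freshG (above (q.X ++ q.V)) := fun v hv =>
    lt_of_lt_of_le (lt_above (List.mem_append_right _ hv)) (le_max_right _ _)
  unfold CountPred.expansion
  cases hrel : q.rel with
  | atLeast =>
      simp only [CountRel.Holds, ge_iff_le]
      by_cases h0 : r ≤ .num 0
      · rw [if_pos h0]
        exact iff_of_true Formula.force_top ⟨∅, by simpa using h0, by simp⟩
      · rw [if_neg h0]
        by_cases hr : ∃ k : ℤ, r = .num k
        · obtain ⟨k, rfl⟩ := hr
          rw [PrecomputedOrder.num_le_num] at h0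
          simp only [force_atLeastF q.freeG hb hV, PrecomputedOrder.num_le_num]
          refine exists_congr fun Δ => and_congr_left fun _ => ?_
          omega
        · -- a non-numeral above `0` exceeds all cardinalities
          push Not at hr
          have hf : ¬ ∃ Δ : Finset (Fin q.X.length → PTerm S), r ≤ .num (Δ.card : ℤ) ∧
              ∀ x ∈ Δ, q.F.Force H T (tupleAssign q.X x g) ρ := fun ⟨Δ, hΔ, _⟩ =>
            absurd hΔ (not_le.2 (PTerm.num_lt_of_not_num hr (not_le.1 h0).le _))
          cases r with
          | num k => exact absurd rfl (hr k)
          | _ => exact iff_of_false id hf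
  | atMost =>
      simp only [CountRel.Holds, gt_iff_lt]
      by_cases h0 : r < .num 0
      · rw [if_pos h0]
        exact iff_of_false id fun h => h ∅ (by simpa using h0) (by simp)
      · rw [if_neg h0]
        by_cases hr : ∃ k : ℤ, r = .num k
        · obtain ⟨k, rfl⟩ := hr
          rw [PTerm.num_lt_num] at h0
          simp only [force_atMostF hHT q.freeG hb hV, PTerm.num_lt_num]
          refine forall_congr' fun Δ => imp_congr_left ?_
          omega
        · push Not at hr
          have ht : ∀ Δ : Finset (Fin q.X.length → PTerm S), r < .num (Δ.card : ℤ) →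
              ¬ ∀ x ∈ Δ, q.F.Force T T (tupleAssign q.X x g) ρ := fun Δ hΔ =>
            absurd hΔ (PTerm.num_lt_of_not_num hr (not_lt.1 h0) _).not_gt
          cases r with
          | num k => exact absurd rfl (hr k)
          | _ => exact iff_of_true Formula.force_top ht

/-- The axioms `Defs` hold in the interpretations `interp₁`. -/
theorem force_of_mem_Defs {J I : Set (PAtom S)} (hJI : J ⊆ I) {D : Formula S (sigma1 S)}
    (hD : D ∈ Defs S) (g : ℕ → PTerm S) (ρ : ℕ → ℤ) :
    D.Force (interp₁ J I) (interp₁ I I) g ρ := by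
  obtain ⟨q, r, rfl⟩ := hD
  rw [Formula.force_allsG]
  intro e
  simp only [Formula.force_iff, Formula.force_toSigma1, CountPred.force_app, PTerm.eval_toGTerm,
    CountPred.force_expansion (interp₀_mono hJI), CountPred.force_expansion (interp₀_mono subset_rfl),
    and_self]

end Counting

/-! ### Values of terms -/

section Values

variable {S : Type}

namespace MTerm

theorem subst_congr {θ θ' : ℕ → Option (PTerm S)} :
    ∀ {t : MTerm S}, (∀ x ∈ t.vars, θ x = θ' x) → t.subst θ = t.subst θ'
  | .pre _, _ => rfl
  | .var x, h => by simp only [subst, h x (by simp [vars])]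
  | .op o t₁ t₂, h => by
      rw [subst, subst, subst_congr fun x hx => h x (List.mem_append_left _ hx),
        subst_congr fun x hx => h x (List.mem_append_right _ hx)]

theorem subst_subst (θ₁ θ₂ : ℕ → Option (PTerm S)) :
    ∀ t : MTerm S, (t.subst θ₁).subst θ₂ = t.subst fun x => (θ₁ x).or (θ₂ x)
  | .pre _ => rfl
  | .var x => by cases h : θ₁ x <;> simp [subst, h]
  | .op o t₁ t₂ => by rw [subst, subst, subst, subst_subst, subst_subst]

theorem mem_vars_subst_iff {θ : ℕ → Option (PTerm S)} {x : ℕ} :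
    ∀ {t : MTerm S}, x ∈ (t.subst θ).vars ↔ x ∈ t.vars ∧ θ x = none
  | .pre _ => by simp [subst, vars]
  | .var y => by
      cases h : θ y
      · simp only [subst, h, vars, List.mem_singleton, iff_self_and]
        rintro rfl; exact h
      · simp only [subst, h, vars, List.mem_singleton, List.not_mem_nil, false_iff, not_and]
        rintro rfl; simp [h]
  | .op o t₁ t₂ => by
      simp only [subst, vars, List.mem_append, mem_vars_subst_iff, or_and_right]

/-- A term without `..` has at most one value. -/
theorem values_subsingleton : ∀ {t : MTerm S}, t.IntervalFree → t.values.Subsingleton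
  | .pre _, _ => Set.subsingleton_singleton
  | .var _, _ => Set.subsingleton_empty
  | .op o t₁ t₂, h => by
      have h₁ := values_subsingleton h.2.1
      have h₂ := values_subsingleton h.2.2
      have e₁ : ∀ {m m' : ℤ}, .num m ∈ t₁.values → .num m' ∈ t₁.values → m = m' :=
        fun h h' => PTerm.num.inj (h₁ h h')
      have e₂ : ∀ {m m' : ℤ}, .num m ∈ t₂.values → .num m' ∈ t₂.values → m = m' :=
        fun h h' => PTerm.num.inj (h₂ h h')
      cases o with
      | interval => exact absurd rfl h.1
      | add | sub | mul =>
          rintro _ ⟨m, n, hm, hn, rfl⟩ _ ⟨m', n', hm', hn', rfl⟩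
          rw [e₁ hm hm', e₂ hn hn']
      | div | mod =>
          rintro _ ⟨m, n, hm, hn, _, rfl⟩ _ ⟨m', n', hm', hn', _, rfl⟩
          rw [e₁ hm hm', e₂ hn hn']

end MTerm

theorem tupleSubst_map_congr {θ θ' : ℕ → Option (PTerm S)} {ts : List (MTerm S)}
    (h : ∀ x ∈ ts.flatMap MTerm.vars, θ x = θ' x) :
    ts.map (MTerm.subst θ) = ts.map (MTerm.subst θ') :=
  List.map_congr_left fun t ht =>
    MTerm.subst_congr fun x hx => h x (List.mem_flatMap.2 ⟨t, ht, hx⟩)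

theorem eq_floor_div_iff {m n k : ℤ} (hn : n ≠ 0) :
    k = ⌊(m : ℚ) / n⌋ ↔
      (0 ≤ m - n * k ∧ m - n * k < n) ∨ (n < m - n * k ∧ m - n * k ≤ 0) := by
  rw [eq_comm, Int.floor_eq_iff]
  rcases hn.lt_or_gt with h | h
  · have h' : (n : ℚ) < 0 := by exact_mod_cast h
    rw [le_div_iff_of_neg h', div_lt_iff_of_neg h']
    norm_cast
    rw [mul_comm k, add_mul, mul_comm k]
    omega
  · have h' : (0 : ℚ) < n := by exact_mod_cast h
    rw [le_div_iff₀ h', div_lt_iff₀ h']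
    norm_cast
    rw [mul_comm k, add_mul, mul_comm k]
    omega

/-- The condition in the translation of `/` and `\` determines the quotient and the remainder. -/
theorem quotient_remainder_iff {m n k r : ℤ} (hn : n ≠ 0) :
    (m = n * k + r ∧ ((0 ≤ r ∧ r < n) ∨ (n < r ∧ r ≤ 0))) ↔
      k = ⌊(m : ℚ) / n⌋ ∧ r = m - n * ⌊(m : ℚ) / n⌋ := by
  constructor
  · rintro ⟨h, hr⟩
    have hr' : r = m - n * k := by omega
    have hk := (eq_floor_div_iff hn).2 (hr' ▸ hr)
    exact ⟨hk, hk ▸ hr'⟩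
  · rintro ⟨hk, hr⟩
    rw [← hk] at hr
    have := (eq_floor_div_iff hn).1 hk
    rw [← hr] at this
    exact ⟨by omega, this⟩

variable [PrecomputedOrder S] {σ : Signature} {H T : Interp S σ}

/-- `val_t(Z)` expresses that `Z` is a value of `t`. The assumption on `Z` prevents capture by the
quantifiers on the integer variables `k, k + 1, …`. -/
theorem MTerm.force_val {g : ℕ → PTerm S} : ∀ {t : MTerm S} {k : ℕ} {Z : GTerm S} {ρ : ℕ → ℤ},
    (∀ n, Z.OccI n → n < k) → ((t.val k Z : Formula S σ).Force H T g ρ ↔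
      Z.eval g ρ ∈ (t.subst fun x => some (g x)).values)
  | .pre r, k, Z, ρ, _ => by simp [val, Formula.Force, CmpSym.Holds, subst, values]
  | .var x, k, Z, ρ, _ => by
      simp [val, Formula.Force, CmpSym.Holds, subst, values, GTerm.eval]
  | .op o t₁ t₂, k, Z, ρ, hZ => by
      have h₁ : ∀ {ρ : ℕ → ℤ}, (t₁.val (k + 4) (.int (.var k)) : Formula S σ).Force H T g ρ ↔
          .num (ρ k) ∈ (t₁.subst fun x => some (g x)).values :=
        MTerm.force_val fun n hn => by
          have : k = n := hn
          omega
      have h₂ : ∀ {ρ : ℕ → ℤ},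
          (t₂.val (k + 4) (.int (.var (k + 1))) : Formula S σ).Force H T g ρ ↔
          .num (ρ (k + 1)) ∈ (t₂.subst fun x => some (g x)).values :=
        MTerm.force_val fun n hn => by
          have : k + 1 = n := hn
          omega
      -- the quantified variables do not occur in `Z`
      have hZ' : ∀ {ρ : ℕ → ℤ} {j m : ℕ} {a : ℤ}, j = k + m →
          Z.eval g (Function.update ρ j a) = Z.eval g ρ := by
        intro ρ j m a hj
        refine GTerm.eval_congr (fun _ _ => rfl) fun n hn => ?_
        have := hZ n hn
        rw [Function.update_of_ne (by omega)]
      have z0 := fun (ρ : ℕ → ℤ) (a : ℤ) => hZ' (ρ := ρ) (a := a) (m := 0) rfl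
      have z1 := fun (ρ : ℕ → ℤ) (a : ℤ) => hZ' (ρ := ρ) (a := a) (m := 1) rfl
      have z2 := fun (ρ : ℕ → ℤ) (a : ℤ) => hZ' (ρ := ρ) (a := a) (m := 2) rfl
      have z3 := fun (ρ : ℕ → ℤ) (a : ℤ) => hZ' (ρ := ρ) (a := a) (m := 3) rfl
      simp only [Nat.add_zero] at z0
      cases o with
      | add | sub | mul =>
          simp only [val, Formula.bigAnd, Formula.Force, h₁, h₂, CmpSym.Holds, z0, z1, subst,
            values, Set.mem_ofPred_eq, GTerm.eval_int, ITerm.eval]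
          simp only [Function.update_self, ne_eq, Nat.left_eq_add, one_ne_zero,
            not_false_eq_true, Function.update_of_ne]
          exact exists₂_congr fun m n => by tauto
      | interval =>
          simp only [val, Formula.bigAnd, Formula.Force, h₁, h₂, CmpSym.Holds, z0, z1, z2, subst,
            values, Set.mem_ofPred_eq, GTerm.eval_int, ITerm.eval, PrecomputedOrder.num_le_num]
          simp
      | div | mod =>
          simp only [val, Formula.bigAnd, Formula.Force, h₁, h₂, CmpSym.Holds, z0, z1, z2, z3,
            subst, values, Set.mem_ofPred_eq, GTerm.eval_int, ITerm.eval, PrecomputedOrder.num_le_num,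
            PTerm.num_lt_num, ne_eq, PTerm.num.injEq]
          simp only [Function.update_apply, Nat.left_eq_add, Nat.add_left_cancel_iff,
            Nat.add_eq_left, OfNat.ofNat_ne_zero, one_ne_zero, if_true, if_false,
            OfNat.one_ne_ofNat, OfNat.ofNat_ne_one, Nat.reduceEqDiff]
          refine exists₂_congr fun m n => ?_
          constructor
          · rintro ⟨K, R, ⟨hm, hv₁, hv₂, hn, hr⟩, hz⟩
            obtain ⟨hK, hR⟩ := (quotient_remainder_iff hn).1 ⟨hm, hr⟩
            exact ⟨hv₁, hv₂, hn, by rw [hz]; first | rw [hK] | rw [hR]⟩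
          · rintro ⟨hv₁, hv₂, hn, hz⟩
            obtain ⟨hm, hr⟩ := (quotient_remainder_iff (m := m) hn).2 ⟨rfl, rfl⟩
            exact ⟨_, _, ⟨hm, hv₁, hv₂, hn, hr⟩, hz⟩

theorem MTerm.force_val_var {g : ℕ → PTerm S} {ρ : ℕ → ℤ} {t : MTerm S} {z : ℕ} :
    (t.val 0 (.var z) : Formula S σ).Force H T g ρ ↔
      g z ∈ (t.subst fun x => some (g x)).values :=
  MTerm.force_val fun _ hn => hn.elim

theorem force_valTuple {g : ℕ → PTerm S} {ρ : ℕ → ℤ} {ts : List (MTerm S)} {Z : List ℕ}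
    (h : Z.length = ts.length) :
    (valTuple ts Z : Formula S σ).Force H T g ρ ↔
      Z.map g ∈ tupleValues (ts.map (MTerm.subst fun x => some (g x))) := by
  rw [valTuple, Formula.force_bigAnd]
  simp only [tupleValues, Set.mem_ofPred_eq, List.forall₂_map_left_iff, List.forall₂_map_right_iff]
  rw [List.forall₂_iff_get]
  constructor
  · intro hF
    refine ⟨h.symm, fun i hi hi' => MTerm.force_val_var.1 (hF _ ?_)⟩
    rw [List.mem_iff_getElem]
    exact ⟨i, by simp; omega, by simp⟩
  · rintro ⟨_, hF⟩ F hF'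
    obtain ⟨i, hi, rfl⟩ := List.getElem_of_mem hF'
    simp only [List.length_zipWith] at hi
    rw [List.getElem_zipWith]
    exact MTerm.force_val_var.2 (hF i (by omega) (by omega))

end Values

/-! ### Literals and comparisons -/

section Basic

variable {S : Type}

theorem Basic.subst_congr {θ θ' : ℕ → Option (PTerm S)} :
    ∀ {B : Basic S}, (∀ x ∈ B.vars, θ x = θ' x) → B.subst θ = B.subst θ'
  | .lit s p ts, h => by rw [subst, subst, tupleSubst_map_congr h]
  | .cmp c t₁ t₂, h => by
      rw [subst, subst, MTerm.subst_congr fun x hx => h x (List.mem_append_left _ hx),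
        MTerm.subst_congr fun x hx => h x (List.mem_append_right _ hx)]

theorem Basic.subst_subst (θ₁ θ₂ : ℕ → Option (PTerm S)) (B : Basic S) :
    (B.subst θ₁).subst θ₂ = B.subst fun x => (θ₁ x).or (θ₂ x) := by
  cases B <;> simp [subst, MTerm.subst_subst]

theorem Basic.mem_vars_subst_iff {θ : ℕ → Option (PTerm S)} {x : ℕ} {B : Basic S} :
    x ∈ (B.subst θ).vars ↔ x ∈ B.vars ∧ θ x = none := by
  cases B with
  | lit s p ts =>
      simp only [subst, vars, List.mem_flatMap, List.mem_map, ↓existsAndEq,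
        MTerm.mem_vars_subst_iff, and_true, exists_and_right, ← and_assoc]
  | cmp c t₁ t₂ => simp only [subst, vars, List.mem_append, MTerm.mem_vars_subst_iff, or_and_right]

theorem mem_conjVars_subst_iff {θ : ℕ → Option (PTerm S)} {x : ℕ} {L : List (Basic S)} :
    x ∈ conjVars (L.map (Basic.subst θ)) ↔ x ∈ conjVars L ∧ θ x = none := by
  simp only [conjVars, List.mem_flatMap, List.mem_map, ↓existsAndEq,
    Basic.mem_vars_subst_iff, and_true, exists_and_right, ← and_assoc]

/-- Every tuple of precomputed terms is a tuple of values of fresh variables. -/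
theorem exists_map_freshList_eq {b n : ℕ} {rs : List (PTerm S)} (h : rs.length = n) :
    ∃ e : ℕ → PTerm S, (freshList b n).map e = rs := by
  refine ⟨fun x => rs.getD (x - b) .inf, ?_⟩
  subst h
  refine List.ext_getElem (by simp [freshList]) fun i h₁ h₂ => ?_
  simp [freshList, h₂]

theorem map_override_of_subset {α : Type} {l Z : List ℕ} {e g : ℕ → α} (h : ∀ x ∈ Z, x ∈ l) :
    Z.map (override l e g) = Z.map e :=
  List.map_congr_left fun x hx => override_of_mem (h x hx)

variable [PrecomputedOrder S] {J I : Set (PAtom S)}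

theorem force_atomF {T : Interp S (sigma0 S)} {p : S} {Z : List ℕ} {g : ℕ → PTerm S}
    {ρ : ℕ → ℤ} :
    (atomF p (Z.map GTerm.var)).Force (interp₀ J) T g ρ ↔ (⟨p, Z.map g⟩ : PAtom S) ∈ J := by
  have : (List.ofFn fun i => ((Z.map GTerm.var : List (GTerm S)).get i).eval g ρ) = Z.map g := by
    refine List.ext_getElem (by simp) fun i h₁ h₂ => ?_
    simp [GTerm.eval]
  rw [← this]
  rfl

theorem Sign.force_applyF {s : Sign} {A : Formula S (sigma0 S)} {a : PAtom S} {g : ℕ → PTerm S}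
    {ρ : ℕ → ℤ} (h : ∀ K : Set (PAtom S), A.Force (interp₀ K) (interp₀ I) g ρ ↔ a ∈ K) :
    (s.applyF A).Force (interp₀ J) (interp₀ I) g ρ ↔ (s.apply (.atom a)).HT J I := by
  cases s <;>
    simp [applyF, apply, Formula.neg, Formula.Force, InfFormula.neg, InfFormula.HT, h,
      InfFormula.not_ht_bot]

/-- `τ^B` represents `τ`, for literals and comparisons. -/
theorem Basic.force_tauB {g : ℕ → PTerm S} {ρ : ℕ → ℤ} {B : Basic S} :
    B.tauB.Force (interp₀ J) (interp₀ I) g ρ ↔ (B.subst fun x => some (g x)).tau.HT J I := by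
  cases B with
  | lit s p ts =>
      simp only [tauB, Formula.force_exsG, subst, tau, InfFormula.HT, Subtype.exists, exists_prop]
      set Z := freshList (above (ts.flatMap MTerm.vars)) ts.length with hZ
      have hlen : Z.length = ts.length := by simp [hZ, freshList]
      have hts : ∀ e : ℕ → PTerm S, ts.map (MTerm.subst fun x => some (override Z e g x)) =
          ts.map (MTerm.subst fun x => some (g x)) := fun e =>
        tupleSubst_map_congr fun x hx => by rw [override_of_notMem (notMem_freshList_above hx)]
      have key : ∀ e : ℕ → PTerm S, ((valTuple ts Z).and
          (s.applyF (atomF p (Z.map GTerm.var)))).Force (interp₀ J) (interp₀ I) (override Z e g) ρ ↔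
          Z.map e ∈ tupleValues (ts.map (MTerm.subst fun x => some (g x))) ∧
            (s.apply (.atom ⟨p, Z.map e⟩)).HT J I := by
        intro e
        simp only [Formula.Force]
        rw [force_valTuple hlen, hts, Sign.force_applyF fun K => force_atomF,
          map_override_of_subset fun _ => id]
      simp only [key]
      constructor
      · rintro ⟨e, he⟩
        exact ⟨_, he⟩
      · rintro ⟨rs, hrs⟩
        have hl : rs.length = ts.length := by
          simpa using (List.Forall₂.length_eq hrs.1).symm
        obtain ⟨e, rfl⟩ := exists_map_freshList_eq (b := above (ts.flatMap MTerm.vars)) hl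
        exact ⟨e, hrs⟩
  | cmp c t₁ t₂ =>
      set z := above (t₁.vars ++ t₂.vars) with hz
      have hov : ∀ (e : ℕ → PTerm S), ∀ x ∈ t₁.vars ++ t₂.vars,
          some (override [z, z + 1] e g x) = some (g x) := by
        intro e x hx
        have := lt_above hx
        rw [override_of_notMem]
        simp only [List.mem_cons, List.not_mem_nil, or_false]
        omega
      have h₁ : ∀ e, (t₁.subst fun x => some (override [z, z + 1] e g x)) =
          t₁.subst fun x => some (g x) := fun e =>
        MTerm.subst_congr fun x hx => hov e x (List.mem_append_left _ hx)
      have h₂ : ∀ e, (t₂.subst fun x => some (override [z, z + 1] e g x)) =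
          t₂.subst fun x => some (g x) := fun e =>
        MTerm.subst_congr fun x hx => hov e x (List.mem_append_right _ hx)
      simp only [tauB, ← hz, Formula.force_exsG, Formula.bigAnd, Formula.Force, MTerm.force_val_var, h₁, h₂,
        GTerm.eval, subst, tau]
      have hov₁ : ∀ e : ℕ → PTerm S, override [z, z + 1] e g z = e z := fun e =>
        override_of_mem (by simp)
      have hov₂ : ∀ e : ℕ → PTerm S, override [z, z + 1] e g (z + 1) = e (z + 1) := fun e =>
        override_of_mem (by simp)
      simp only [hov₁, hov₂]
      rw [InfFormula.ht_ite]
      constructor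
      · rintro ⟨e, h₁, h₂, h₃⟩
        exact ⟨_, h₁, _, h₂, h₃⟩
      · rintro ⟨r₁, h₁, r₂, h₂, h₃⟩
        exact ⟨fun x => if x = z then r₁ else r₂, by simpa using h₁, by simpa using h₂,
          by simpa using h₃⟩

end Basic

/-! ### Rules and programs -/

section Rules

variable {S : Type}

/-- The substitution of the values of global variables. -/
def globalSubst (glob : List ℕ) (g : ℕ → PTerm S) : ℕ → Option (PTerm S) :=
  fun x => if x ∈ glob then some (g x) else none

theorem globalSubst_of_mem {glob : List ℕ} {g : ℕ → PTerm S} {x : ℕ} (h : x ∈ glob) :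
    globalSubst glob g x = some (g x) := if_pos h

theorem Rule.mem_globals_of_mem_head {R : Rule S} {x : ℕ} (h : x ∈ R.head.vars) : x ∈ R.globals :=
  List.mem_dedup.2 (List.mem_append_left _ h)

theorem Rule.mem_globals_of_mem_body {R : Rule S} {B : BodyElem S} (hB : B ∈ R.body) {x : ℕ}
    (h : x ∈ B.outerVars) : x ∈ R.globals :=
  List.mem_dedup.2 (List.mem_append_right _ (List.mem_flatMap.2 ⟨B, hB, h⟩))

variable [PrecomputedOrder S] {J I : Set (PAtom S)}

theorem force_conjTauB {L : List (Basic S)} {g : ℕ → PTerm S} {ρ : ℕ → ℤ} :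
    (conjTauB L).Force (interp₀ J) (interp₀ I) g ρ ↔
      ∀ B ∈ L, (B.subst fun x => some (g x)).tau.HT J I := by
  simp only [conjTauB, Formula.force_bigAnd, List.forall_mem_map, Basic.force_tauB]

/-- The subscript of the predicate constant representing an aggregate atom expresses the condition
that a tuple has to satisfy in order to be counted. -/
theorem AggElem.ht_tauAt {E : AggElem S} {glob : List ℕ} {rel : CountRel} {g : ℕ → PTerm S}
    {ρ : ℕ → ℤ} (x : Fin E.X.length → PTerm S) :
    ((E.subst (globalSubst glob g)).tauAt x).HT J I ↔
      (E.countPred rel glob).F.Force (interp₀ J) (interp₀ I) (tupleAssign E.X x g) ρ := by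
  -- the variables bound by `∃W` are those left after substituting for `X` and for the globals
  have hW : ∀ v, v ∈ (E.subst (globalSubst glob g)).otherVars ↔
      v ∈ (conjVars E.L).dedup.filter fun v => v ∉ glob ∧ v ∉ E.X := by
    intro v
    simp only [otherVars, AggElem.subst, List.mem_filter, List.mem_dedup, mem_conjVars_subst_iff,
      decide_eq_true_eq, globalSubst]
    by_cases hX : v ∈ E.X <;> by_cases hg : v ∈ glob <;> simp [hX, hg]
  set W := (conjVars E.L).dedup.filter fun v => v ∉ glob ∧ v ∉ E.X with hWdef
  have hov : ∀ e : ℕ → PTerm S, override W e (tupleAssign E.X x g) =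
      override (E.subst (globalSubst glob g)).otherVars e (tupleAssign E.X x g) := by
    intro e
    funext v
    simp only [override, hW]
  have hF : (E.countPred rel glob).F.Force (interp₀ J) (interp₀ I) (tupleAssign E.X x g) ρ ↔
      ∃ e, ∀ B ∈ E.L, (B.subst fun v => some (override (E.subst (globalSubst glob g)).otherVars e
        (tupleAssign E.X x g) v)).tau.HT J I := by
    simp only [countPred, Formula.force_exsG, force_conjTauB, ← hWdef, hov]
  rw [hF, exists_override_iff (P := fun g' => ∀ B ∈ E.L,
    (B.subst fun v => some (g' v)).tau.HT J I)]
  refine exists_congr fun w => ?_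
  have hL : (E.subst (globalSubst glob g)).L =
      E.L.map (Basic.subst fun v => if v ∈ E.X then none else globalSubst glob g v) := rfl
  rw [InfFormula.ht_listConj, List.forall_mem_map, hL, List.forall_mem_map]
  refine forall₂_congr fun B hB => ?_
  rw [Basic.subst_subst, Basic.subst_subst]
  refine iff_of_eq (congrArg (fun B : Basic S => B.tau.HT J I) (Basic.subst_congr fun v hv => ?_))
  have hL : v ∈ conjVars E.L := List.mem_flatMap.2 ⟨B, hB, hv⟩
  have hmem := hW v
  simp only [hWdef, List.mem_filter, List.mem_dedup, hL, true_and, decide_eq_true_eq] at hmem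
  change (if v ∈ E.X then none else globalSubst glob g v).or ((tupleSubst E.X x v).or
    (tupleSubst (E.subst (globalSubst glob g)).otherVars w v)) = _
  by_cases hX : v ∈ E.X
  · have hv' : v ∉ (E.subst (globalSubst glob g)).otherVars := fun h => (hmem.1 h).2 hX
    rw [if_pos hX, Option.none_or, tupleSubst_of_mem g hX, Option.some_or,
      tupleAssign_of_notMem hv']
  · rw [if_neg hX, tupleSubst_of_notMem hX]
    by_cases hg : v ∈ glob
    · have hv' : v ∉ (E.subst (globalSubst glob g)).otherVars := fun h => (hmem.1 h).1 hg
      rw [globalSubst_of_mem hg, tupleAssign_of_notMem hv', tupleAssign_of_notMem hX]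
      rfl
    · have hv' : v ∈ (E.subst (globalSubst glob g)).otherVars := hmem.2 ⟨hg, hX⟩
      have hn : globalSubst glob g v = none := if_neg hg
      rw [hn]
      exact tupleSubst_of_mem _ hv'

/-- The formula `B*` represents `τ(B)`, for the members `B` of the body of a rule. -/
theorem BodyElem.force_star (hJI : J ⊆ I) {glob : List ℕ} {g : ℕ → PTerm S} {ρ : ℕ → ℤ}
    {B : BodyElem S} (hB : ∀ x ∈ B.outerVars, x ∈ glob) :
    (B.star glob).Force (interp₁ J I) (interp₁ I I) g ρ ↔
      (B.subst (globalSubst glob g)).tau.HT J I := by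
  cases B with
  | basic B =>
      rw [star, Formula.force_toSigma1, Basic.force_tauB,
        Basic.subst_congr fun x hx => (globalSubst_of_mem (hB x hx)).symm]
      rfl
  | count rel E t ht =>
      -- the fresh variable for the value of `t` occurs neither in `t` nor in the subscript
      have hfresh : ∀ x ∈ t.vars ++ conjVars E.L, x ≠ above (t.vars ++ conjVars E.L) :=
        fun x hx => (lt_above hx).ne
      set z := above (t.vars ++ conjVars E.L) with hz
      have hval : ∀ r, (t.val 0 (.var z) : Formula S (sigma1 S)).Force (interp₁ J I) (interp₁ I I)
          (Function.update g z r) ρ ↔ r ∈ (t.subst (globalSubst glob g)).values := by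
        intro r
        rw [MTerm.force_val_var, Function.update_self,
          MTerm.subst_congr fun x hx => ?_]
        rw [globalSubst_of_mem (hB x hx), Function.update_of_ne (hfresh x (by simp [hx]))]
      have hF : ∀ (K : Set (PAtom S)) (x : Fin E.X.length → PTerm S) r,
          (E.countPred rel glob).F.Force (interp₀ K) (interp₀ I)
            (tupleAssign E.X x (Function.update g z r)) ρ =
          ((E.subst (globalSubst glob g)).tauAt x).HT K I := by
        intro K x r
        rw [AggElem.ht_tauAt (rel := rel) (ρ := ρ)]
        refine propext (Formula.force_congr (fun v hv => ?_) fun _ _ => rfl)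
        by_cases hX : v ∈ E.X
        · rw [tupleAssign_of_mem hX, tupleAssign_of_mem hX]
        · have hV : v ∈ (E.countPred rel glob).V :=
            ((E.countPred rel glob).freeG v hv).resolve_left hX
          have hL : v ∈ conjVars E.L := List.mem_dedup.1 (List.mem_filter.1 hV).1
          rw [tupleAssign_of_notMem hX, tupleAssign_of_notMem hX,
            Function.update_of_ne (hfresh v (by simp [hL]))]
      have hstar : ((BodyElem.count rel E t ht).star glob).Force (interp₁ J I) (interp₁ I I) g ρ ↔
          ∃ r ∈ (t.subst (globalSubst glob g)).values, rel.Holds r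
            (fun x => ((E.subst (globalSubst glob g)).tauAt x).HT J I)
            (fun x => ((E.subst (globalSubst glob g)).tauAt x).HT I I) := by
        refine exists_congr fun r => and_congr (hval r) ?_
        rw [CountPred.force_app, GTerm.eval_var, Function.update_self]
        exact iff_of_eq (congrArg₂ (rel.Holds r) (funext fun x => hF J x r)
          (funext fun x => hF I x r))
      rw [hstar, BodyElem.subst, BodyElem.tau]
      split
      · next hne =>
          have hex : (∃ r ∈ (t.subst (globalSubst glob g)).values, rel.Holds r
              (fun x => ((E.subst (globalSubst glob g)).tauAt x).HT J I)
              (fun x => ((E.subst (globalSubst glob g)).tauAt x).HT I I)) ↔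
              rel.Holds hne.some
              (fun x => ((E.subst (globalSubst glob g)).tauAt x).HT J I)
              (fun x => ((E.subst (globalSubst glob g)).tauAt x).HT I I) := by
            constructor
            · -- `t` is interval-free, so that `r` is the value selected in `BodyElem.tau`
              rintro ⟨r, hr, h⟩
              rwa [MTerm.values_subsingleton (ht.subst _) hne.some_mem hr]
            · exact fun h => ⟨_, hne.some_mem, h⟩
          rw [hex]
          cases rel with
          | atLeast =>
              simp only [CountRel.Holds, InfFormula.HT, Subtype.exists, Subtype.forall, exists_prop]
          | atMost =>
              simp only [CountRel.Holds, InfFormula.HT, Subtype.forall, InfFormula.ht_neg hJI]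
      · next hne =>
          exact iff_of_false (fun ⟨r, hr, _⟩ => hne ⟨r, hr⟩) InfFormula.not_ht_bot

namespace Rule

variable {R : Rule S}

/-- The closed instance of the body of a rule is satisfied. -/
def BodyHT (R : Rule S) (v : ℕ → PTerm S) (J I : Set (PAtom S)) : Prop :=
  ∀ B ∈ R.body, (B.subst (globalSubst R.globals v)).tau.HT J I

theorem ht_listConj_body {v : ℕ → PTerm S} :
    (InfFormula.listConj ((R.inst v).body.map BodyElem.tau)).HT J I ↔ R.BodyHT v J I := by
  rw [InfFormula.ht_listConj, List.forall_mem_map]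
  exact List.forall_mem_map

theorem force_body (hJI : J ⊆ I) {g : ℕ → PTerm S} {ρ : ℕ → ℤ} :
    (∀ F ∈ R.body.map (BodyElem.star R.globals), F.Force (interp₁ J I) (interp₁ I I) g ρ) ↔
      R.BodyHT g J I := by
  rw [List.forall_mem_map]
  exact forall₂_congr fun B hB => BodyElem.force_star hJI fun x => mem_globals_of_mem_body hB

theorem bodyHT_congr {v v' : ℕ → PTerm S} (h : ∀ x ∈ R.globals, v x = v' x) :
    R.BodyHT v J I ↔ R.BodyHT v' J I := by
  have : globalSubst R.globals v = globalSubst R.globals v' := by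
    funext x
    simp only [globalSubst]
    split
    · next hx => rw [h x hx]
    · rfl
  rw [BodyHT, BodyHT, this]

/-- Rules with a nonempty head `p(t)` or `{p(t)}`: the quantification over the values of `t` in
the conclusion of `τ(R)` corresponds to the quantification over fresh variables in `τ*(R)`. -/
theorem force_allsG_head_iff (hJI : J ⊆ I) {ts : List (MTerm S)}
    (hts : ∀ x ∈ ts.flatMap MTerm.vars, x ∈ R.globals) {A : Formula S (sigma1 S)}
    {C : List (PTerm S) → InfFormula (PAtom S)} {g : ℕ → PTerm S} {ρ : ℕ → ℤ}
    (hA : ∀ K : Set (PAtom S), K ⊆ I → ∀ g' : ℕ → PTerm S,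
      (A.Force (interp₁ K I) (interp₁ I I) g' ρ ↔
        (C ((freshList (above R.globals) ts.length).map g')).HT K I)) :
    (Formula.allsG (R.globals ++ freshList (above R.globals) ts.length)
      (.imp (.bigAnd (R.body.map (BodyElem.star R.globals) ++
        [valTuple ts (freshList (above R.globals) ts.length)])) A)).Force
          (interp₁ J I) (interp₁ I I) g ρ ↔
      ∀ v, (InfFormula.imp (.listConj ((R.inst v).body.map BodyElem.tau))
        (.conj {rs : List (PTerm S) //
          rs ∈ tupleValues (ts.map (MTerm.subst (globalSubst R.globals v)))}
          fun rs => C rs.1)).HT J I := by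
  set Z := freshList (above R.globals) ts.length with hZ
  have hlen : Z.length = ts.length := by simp [hZ, freshList]
  have hbody : ∀ (K : Set (PAtom S)), K ⊆ I → ∀ e : ℕ → PTerm S,
      ((Formula.bigAnd (R.body.map (BodyElem.star R.globals) ++ [valTuple ts Z])).Force
        (interp₁ K I) (interp₁ I I) (override (R.globals ++ Z) e g) ρ ↔
      R.BodyHT e K I ∧
        Z.map e ∈ tupleValues (ts.map (MTerm.subst (globalSubst R.globals e)))) := by
    intro K hK e
    have hov : ∀ x ∈ R.globals, override (R.globals ++ Z) e g x = e x := fun x hx =>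
      override_of_mem (List.mem_append_left _ hx)
    rw [Formula.force_bigAnd, List.forall_mem_append, force_body hK, List.forall_mem_singleton,
      force_valTuple hlen, bodyHT_congr hov,
      map_override_of_subset fun x hx => List.mem_append_right _ hx,
      tupleSubst_map_congr fun x hx => ?_]
    rw [globalSubst_of_mem (hts x hx), hov x (hts x hx)]
  have hA' : ∀ (K : Set (PAtom S)), K ⊆ I → ∀ e : ℕ → PTerm S,
      (A.Force (interp₁ K I) (interp₁ I I) (override (R.globals ++ Z) e g) ρ ↔
        (C (Z.map e)).HT K I) := by
    intro K hK e
    rw [hA K hK, map_override_of_subset fun x hx => List.mem_append_right _ hx]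
  rw [Formula.force_allsG]
  simp only [Formula.Force, hbody J hJI, hbody I subset_rfl, hA' J hJI, hA' I subset_rfl,
    InfFormula.HT, ht_listConj_body, Subtype.forall]
  constructor
  · intro h v
    -- the fresh variables are not global, so they can be given the values `rs` without changing
    -- the instance of the rule
    have key : ∀ rs ∈ tupleValues (ts.map (MTerm.subst (globalSubst R.globals v))),
        (R.BodyHT v J I → (C rs).HT J I) ∧ (R.BodyHT v I I → (C rs).HT I I) := by
      intro rs hrs
      have hl : rs.length = ts.length := by simpa using (List.Forall₂.length_eq hrs).symm
      obtain ⟨e, he⟩ := exists_map_freshList_eq (b := above R.globals) hl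
      have hv : ∀ x ∈ R.globals, v x = override Z e v x := fun x hx =>
        (override_of_notMem (notMem_freshList_above hx)).symm
      have hrs' : Z.map (override Z e v) = rs := by
        rw [map_override_of_subset fun _ => id, hZ, he]
      have hts' : ts.map (MTerm.subst (globalSubst R.globals v)) =
          ts.map (MTerm.subst (globalSubst R.globals (override Z e v))) :=
        tupleSubst_map_congr fun x hx => by
          rw [globalSubst_of_mem (hts x hx), globalSubst_of_mem (hts x hx), hv x (hts x hx)]
      have h' := h (override Z e v)
      rw [hrs', ← hts', ← bodyHT_congr hv, ← bodyHT_congr hv] at h'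
      exact ⟨fun hb => h'.1 ⟨hb, hrs⟩, fun hb => h'.2 ⟨hb, hrs⟩⟩
    exact ⟨fun hb rs hrs => (key rs hrs).1 hb, fun hb rs hrs => (key rs hrs).2 hb⟩
  · exact fun h e => ⟨fun hb => (h e).1 hb.1 _ hb.2, fun hb => (h e).2 hb.1 _ hb.2⟩

/-- The sentence `τ*(R)` represents the conjunction of the formulas `τ` of the instances of `R`. -/
theorem force_tauStar (hJI : J ⊆ I) {g : ℕ → PTerm S} {ρ : ℕ → ℤ} :
    R.tauStar.Force (interp₁ J I) (interp₁ I I) g ρ ↔ ∀ v, (R.inst v).tau.HT J I := by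
  have hatom : ∀ (p : S) (Z : List ℕ) (K : Set (PAtom S)) (g' : ℕ → PTerm S),
      (atomF p (Z.map GTerm.var)).toSigma1.Force (interp₁ K I) (interp₁ I I) g' ρ ↔
        (InfFormula.atom (⟨p, Z.map g'⟩ : PAtom S)).HT K I := by
    intro p Z K g'
    rw [Formula.force_toSigma1, force_atomF]
    rfl
  have hvars : ∀ x ∈ R.head.vars, x ∈ R.globals := fun x => mem_globals_of_mem_head
  obtain ⟨head, body⟩ := R
  cases head with
  | atom p ts =>
      exact force_allsG_head_iff hJI hvars (C := fun rs => .atom ⟨p, rs⟩) fun K _ g' => hatom p _ K g'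
  | choice p ts =>
      refine force_allsG_head_iff hJI hvars
        (C := fun rs => .or (.atom ⟨p, rs⟩) (InfFormula.neg (.atom ⟨p, rs⟩))) fun K hK g' => ?_
      simp only [InfFormula.ht_or, Formula.Force, Formula.neg, InfFormula.neg, InfFormula.HT, hatom,
        InfFormula.not_ht_bot]
  | empty =>
      simp only [tauStar, Formula.force_allsG, Formula.neg, Formula.Force]
      have hov : ∀ (e : ℕ → PTerm S) (K : Set (PAtom S)), K ⊆ I →
          ((Formula.bigAnd (body.map (BodyElem.star (Rule.mk .empty body).globals))).Force
            (interp₁ K I) (interp₁ I I) (override (Rule.mk .empty body).globals e g) ρ ↔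
          (Rule.mk .empty body).BodyHT e K I) := by
        intro e K hK
        rw [Formula.force_bigAnd, ← bodyHT_congr fun x hx => override_of_mem hx]
        exact force_body (R := ⟨.empty, body⟩) hK
      refine forall_congr' fun e => ?_
      rw [hov e J hJI, hov e I subset_rfl]
      have hbody := fun K => ht_listConj_body (R := ⟨.empty, body⟩) (v := e) (J := K) (I := I)
      change _ ↔ (InfFormula.neg (.listConj ((Rule.inst ⟨.empty, body⟩ e).body.map
        BodyElem.tau))).HT J I
      simp only [InfFormula.neg, InfFormula.HT, InfFormula.not_ht_bot, hbody]

end Rule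

/-- The sentence `τ*(Π)` represents `τ(Π)`. -/
theorem Program.force_tauStar (hJI : J ⊆ I) {P : Program S} {g : ℕ → PTerm S} {ρ : ℕ → ℤ} :
    P.tauStar.Force (interp₁ J I) (interp₁ I I) g ρ ↔ P.tau.HT J I := by
  simp only [tauStar, Formula.force_bigAnd, List.forall_mem_map, Rule.force_tauStar hJI, tau,
    InfFormula.HT, Prod.forall, List.forall_mem_iff_get]

end Rules

end MGC

theorem theorem3 {S : Type} [MGC.PrecomputedOrder S] (P₁ P₂ : MGC.Program S)
    (h : MGC.HTAEquivalent (MGC.Defs S) P₁.tauStar P₂.tauStar) :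
    MGC.Program.StronglyEquivalent P₁ P₂ := by
  refine MGC.InfFormula.stronglyEquivalent_of_ht fun J I hJI => ?_
  have hiff := MGC.HTA.force h (MGC.interp₁_mono hJI) (fun _ => MGC.force_of_mem_Defs hJI)
    (fun _ => .inf) 0 (by simp)
  rw [← MGC.Program.force_tauStar hJI, ← MGC.Program.force_tauStar hJI]
  exact (MGC.Formula.force_iff.1 hiff).1
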